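/- Fix integers $n\ge 3$ and $1\le \ell\le n-2$, and write points of $\mathbb R^n$ as $(X,y,z,w)\in\mathbb R^\ell\times\mathbb R\times\mathbb R\times\mathbb R^{n-\ell-2}$ with $X=(x_1,\dots,x_\ell)$. For $m\ge 1$ put $\lambda_m=8\pi m$, $\eta_m=e^{-\lambda_m}\lambda_m^{-4}$, and $$u_{m,\ell}(X,y,z,w)=|X|^2-\ell y^2+\eta_m e^{\lambda_m x_1}\cos(\lambda_m z),\qquad Z_{m,\ell}=\{u_{m,\ell}=0\}\cap B_{1/2}(0).$$ Let $\Phi_{m,\ell}(X,z)=|X|^2+\eta_m e^{\lambda_m x_1}\cos(\lambda_m z)$ on $\mathbb R^{\ell+1}$, let $R_\ell=\{|X|\le \tfrac1{16}\}\times[-\tfrac14,\tfrac14]\subset\mathbb R^{\ell+1}$, let $\pi(X,y,z,w)=(X,z)$, and for $j=-m,\dots,m-1$ let $$H_j=\{(X,z)\in R_\ell:\ \tfrac{\pi}{2}+2\pi j<\lambda_m z<\tfrac{3\pi}{2}+2\pi j,\ \Phi_{m,\ell}(X,z)<0\}.$$ There are a constant $C$ and an integer $m_0$, depending only on $n$ and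 $\ell$, such that for every $m\ge m_0$ the function $u_{m,\ell}$ is harmonic on $B_1(0)\subset\mathbb R^n$ and: (i) $\int_{\partial B_1(0)}u_{m,\ell}^2>0$, and the Almgren frequency at scale $1$ satisfies $$\mathcal N_1(u_{m,\ell})=\frac{\int_{B_1(0)}|\nabla u_{m,\ell}|^2}{\int_{\partial B_1(0)}u_{m,\ell}^2}\le C;$$ (ii) zero is a regular value of $u_{m,\ell}$ on $B_1(0)$, that is, $\nabla u_{m,\ell}\ne 0$ at every zero of $u_{m,\ell}$ in $B_1(0)$, and $u_{m,\ell}$ has vanishing order exactly $1$ at every point of $Z_{m,\ell}$; (iii) for every field $\mathbb F$, $b_\ell(Z_{m,\ell};\mathbb F)=\dim_{\mathbb F}H_\ell(Z_{m,\ell};\mathbb F)\ge 2m$ (singular homology). Moreover, the $2m$ sets $H_j$ are open, connected and pairwise disjoint, and $\pi(Z_{m,\ell})\cap R_\ell=R_\ell\setminus\bigcup_jH_j$. There are topological embeddings $\gamma_j:S^\ell\to Z_{m,\ell}$, $j=-m,\dots,m-1$, such that $\pi\circ\gamma_j$ is an embedding with image $\partial H_j$. For every choice of points $p_j\in H_j$,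 the projection $\pi$ maps $Z_{m,\ell}$ into $\mathbb R^{\ell+1}\setminus\{p_{-m},\dots,p_{m-1}\}$, and for every field $\mathbb F$ there is a generator $c$ of $H_\ell(S^\ell;\mathbb F)$ such that the $2m$ classes $(\pi\circ\gamma_j)_*c$ are linearly independent in $H_\ell(\mathbb R^{\ell+1}\setminus\{p_{-m},\dots,p_{m-1}\};\mathbb F)$. -/

import Mathlib

open MeasureTheory

universe v

namespace NodalTopology

noncomputable section

/-- `ℝⁿ` with its Euclidean norm. -/
abbrev E (n : ℕ) : Type := EuclideanSpace ℝ (Fin n)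

/-! ### Analytic notions -/

/-- The integral of `u²` over `∂B_r(0) ⊂ ℝⁿ` with respect to surface measure, written on the unit
sphere (`volume.toSphere` is the surface measure of the unit sphere). -/
def sphereIntegralSq {n : ℕ} (u : E n → ℝ) (r : ℝ) : ℝ :=
  r ^ (n - 1) * ∫ ω : Metric.sphere (0 : E n) 1, u (r • (ω : E n)) ^ 2
    ∂((volume : Measure (E n)).toSphere)

/-- The Almgren frequency `r ∫_{B_r} |∇u|² / ∫_{∂B_r} u²`. -/
def frequency {n : ℕ} (u : E n → ℝ) (r : ℝ) : ℝ :=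
  (r * ∫ x in Metric.ball (0 : E n) r, ‖gradient u x‖ ^ 2) / sphereIntegralSq u r

/-- The vanishing order of `u` at `x`: the least order of a nonzero derivative of `u` at `x`
(the function itself being its derivative of order `0`), and `⊤` if there is none. -/
def vanishingOrder {n : ℕ} (u : E n → ℝ) (x : E n) : ℕ∞ :=
  sInf {d : ℕ∞ | ∃ k : ℕ, d = k ∧ iteratedFDeriv ℝ k u x ≠ 0}

/-! ### Singular homology with coefficients in a field -/

instance hasCoproducts_moduleCat (F : Type v) [Field F] :
    CategoryTheory.Limits.HasCoproducts.{0} (ModuleCat.{v} F) :=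
  CategoryTheory.Limits.hasCoproducts_shrink.{0, v}

/-- `H_k(X; F)`. -/
abbrev Homology (F : Type v) [Field F] (k : ℕ) (X : Type) [TopologicalSpace X] : Type v :=
  ((AlgebraicTopology.singularHomologyFunctor (ModuleCat.{v} F) k).obj
    (ModuleCat.of F F)).obj (TopCat.of X)

/-- The map `f_* : H_k(X; F) → H_k(Y; F)` induced by a continuous map `f : X → Y`. -/
def homologyMap (F : Type v) [Field F] (k : ℕ) {X Y : Type} [TopologicalSpace X]
    [TopologicalSpace Y] (f : C(X, Y)) : Homology F k X →ₗ[F] Homology F k Y :=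
  (((AlgebraicTopology.singularHomologyFunctor (ModuleCat.{v} F) k).obj
    (ModuleCat.of F F)).map (TopCat.ofHom f)).hom

/-- The Betti number `b_k(X; F) = dim_F H_k(X; F)`, as a cardinal. -/
def betti (F : Type v) [Field F] (k : ℕ) (X : Type) [TopologicalSpace X] : Cardinal.{v} :=
  Module.rank F (Homology F k X)

/-! ### The functions

Points of `ℝⁿ` are written `(X, y, z, w) ∈ ℝ^ℓ × ℝ × ℝ × ℝ^(n-ℓ-2)`: the coordinates with indices
`0, …, ℓ - 1` form `X = (x₁, …, x_ℓ)`, index `ℓ` is `y`, index `ℓ + 1` is `z`, and the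
remaining ones form `w`. -/

/-- `λ_m = 8πm`. -/
def lam (m : ℕ) : ℝ := 8 * Real.pi * m

/-- `η_m = e^{-λ_m} λ_m^{-4}`. -/
def eta (m : ℕ) : ℝ := Real.exp (-lam m) * (lam m ^ 4)⁻¹

/-- `u_{m,ℓ} = |X|² - ℓ y² + η_m e^{λ_m x₁} cos(λ_m z)` on `ℝⁿ`. -/
def u (n l : ℕ) (h : l + 2 ≤ n) (m : ℕ) (x : E n) : ℝ :=
  (∑ i : Fin l, x ⟨i, by omega⟩ ^ 2) - l * x ⟨l, by omega⟩ ^ 2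
    + eta m * Real.exp (lam m * x ⟨0, by omega⟩) * Real.cos (lam m * x ⟨l + 1, by omega⟩)

/-- The nodal set `{u_{m,ℓ} = 0} ∩ B_{1/2}(0)`. -/
def nodalSet (n l : ℕ) (h : l + 2 ≤ n) (m : ℕ) : Set (E n) :=
  {x | u n l h m x = 0} ∩ Metric.ball 0 (1 / 2)

/-- The projection `(X, y, z, w) ↦ (X, z)` from `ℝⁿ` to `ℝ^(ℓ+1)`. -/
def proj (n l : ℕ) (h : l + 2 ≤ n) (x : E n) : E (l + 1) :=
  WithLp.toLp 2 (Fin.snoc (α := fun _ => ℝ) (fun i : Fin l => x ⟨i, by omega⟩)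
    (x ⟨l + 1, by omega⟩))

/-! ### The holes, in `ℝ^(ℓ+1)` with coordinates `(X, z)`, `z` being the last one -/

/-- `Φ_{m,ℓ}(X, z) = |X|² + η_m e^{λ_m x₁} cos(λ_m z)`. -/
def Phi (l m : ℕ) (q : E (l + 1)) : ℝ :=
  (∑ i : Fin l, q i.castSucc ^ 2)
    + eta m * Real.exp (lam m * q 0) * Real.cos (lam m * q (Fin.last l))

/-- The box `{|X| ≤ 1/16} × [-1/4, 1/4]`. -/
def box (l : ℕ) : Set (E (l + 1)) :=
  {q | ∑ i : Fin l, q i.castSucc ^ 2 ≤ (1 / 16) ^ 2 ∧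
    q (Fin.last l) ∈ Set.Icc (-(1 / 4) : ℝ) (1 / 4)}

/-- The hole with index `k`: the points `(X, z)` of the box with `Φ_{m,ℓ}(X, z) < 0` and
`π/2 + 2πk < λ_m z < 3π/2 + 2πk`. -/
def hole (l m : ℕ) (k : ℤ) : Set (E (l + 1)) :=
  {q | q ∈ box l ∧
    q (Fin.last l) ∈ Set.Ioo ((Real.pi / 2 + 2 * Real.pi * k) / lam m)
      ((3 * Real.pi / 2 + 2 * Real.pi * k) / lam m) ∧
    Phi l m q < 0}

/-- The `2m` holes, with indices `k = -m, …, m - 1`. -/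
def holes (l m : ℕ) (j : Fin (2 * m)) : Set (E (l + 1)) :=
  hole l m ((j : ℤ) - m)

end

end NodalTopology

open NodalTopology

/-! Write `u = Φ(X, z) - ℓ y²`. A point `(X, z)` of the box lies under the nodal set exactly when `Φ
≥ 0`: solve for `y` and put `w = 0`. The missing part of the box is `{Φ < 0}`. As `|X|² ≥ 0`, such
points need `cos(λz) < 0`, so they fall into slabs in `z`. There are `2m` of these, since `|λz| ≤
2πm` on the box.

The decisive fact is that each hole is convex (`convex_hole`). Inside a slab, `Φ < 0` reads `|X|²
e^{-λx₁} < η cos θ` with `|θ| < π/2`. The right side is concave in `θ`, and the left side is convex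
along segments with `|X| ≤ 1/(2λ)` (`convexOn_quadratic_mul_exp`). The size of `η` forces `|X| <
λ⁻²` in a hole. A bounded open convex set is carried to the unit ball, and its boundary to the unit
sphere, by a homeomorphism of the whole space. On the boundary `Φ = 0`, so this sphere lifts to the
nodal set at height `y = 0`.

For homology, choose a point in every hole; the projection of the nodal set avoids all of them.
Filling in every puncture except `p i` kills the sphere around hole `j ≠ i`, which contracts inside
its own closed hole, but not the sphere around hole `i` (`linearIndependent_homologyMap`). So the
projected classes are independent, hence so are the classes in the nodal set, and the Betti bound
follows. The input is that `H_ℓ(S^ℓ)` is one-dimensional. It comes from augmented singular chains,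
barycentric subdivision and a Mayer–Vietoris induction on `ℝ^k \ {0}`, and is then transferred to
the categorical singular complex.

The analytic claims rest on `η e^{λx₁} ≤ λ⁻⁴` on the unit ball: `u` is a small perturbation of `|X|²
- ℓy²` with gradient bounded independently of `m`, which bounds the frequency. At a critical zero
the equations would leave only `x₁ = 0` or `x₁ = 2/λ`; the first is incompatible with a nonzero
oscillating term, the second with its smallness (`fderiv_u_ne_zero`). -/

/-! ## Chains of vertex lists -/

namespace ListChain

open Finsupp

variable (R : Type*) [CommRing R] {K K' : Type*}

/-- Prepending a vertex to all lists of a chain. -/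
noncomputable def cone (a : K) : (List K →₀ R) →ₗ[R] (List K →₀ R) :=
  lmapDomain R R (List.cons a)

variable {R} in
@[simp]
theorem cone_single (a : K) (l : List K) (r : R) :
    cone R a (single l r) = single (a :: l) r := mapDomain_single

/-- The boundary of a list, in the augmented complex. -/
noncomputable def boundaryAux : List K → (List K →₀ R)
  -- A one-vertex list has the empty list as its boundary. This is the augmentation, so the homology
  -- obtained is reduced.
  | [] => 0
  | a :: l => single l 1 - cone R a (boundaryAux l)

/-- The alternating sum of the sublists with one entry deleted. -/
noncomputable def boundary : (List K →₀ R) →ₗ[R] (List K →₀ R) :=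
  linearCombination R (boundaryAux R)

@[simp]
theorem boundary_nil : boundary R (single ([] : List K) 1) = 0 := by
  simp [boundary, boundaryAux]

theorem boundary_single_cons (a : K) (l : List K) :
    boundary R (single (a :: l) 1) = single l 1 - cone R a (boundary R (single l 1)) := by
  simp [boundary, boundaryAux]

/-- Coning is a contraction of the augmented complex: `∂a + a∂ = id`. The identities for subdivision
and prisms are consequences of this one. -/
theorem boundary_cone (a : K) (c : List K →₀ R) :
    boundary R (cone R a c) = c - cone R a (boundary R c) := by
  have : boundary R ∘ₗ cone R a = LinearMap.id - cone R a ∘ₗ boundary R := by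
    ext l : 2
    simp [boundary_single_cons]
  exact LinearMap.congr_fun this c

theorem boundary_boundary (c : List K →₀ R) : boundary R (boundary R c) = 0 := by
  have : boundary R ∘ₗ boundary R = (0 : (List K →₀ R) →ₗ[R] _) := by
    ext l : 2
    simp only [LinearMap.comp_apply, lsingle_apply, LinearMap.zero_apply]
    induction l with
    | nil => simp
    | cons a l ih => simp [boundary_single_cons, boundary_cone, ih]
  exact LinearMap.congr_fun this c

/-- The chain map induced by a map on vertices. -/
noncomputable def map (f : K → K') : (List K →₀ R) →ₗ[R] (List K' →₀ R) :=
  lmapDomain R R (List.map f)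

variable {R} in
@[simp]
theorem map_single (f : K → K') (l : List K) (r : R) :
    map R f (single l r) = single (l.map f) r := mapDomain_single

theorem map_cone (f : K → K') (a : K) (c : List K →₀ R) :
    map R f (cone R a c) = cone R (f a) (map R f c) := by
  have : map R f ∘ₗ cone R a = cone R (f a) ∘ₗ map R f := by
    ext l : 2
    simp
  exact LinearMap.congr_fun this c

theorem map_boundary (f : K → K') (c : List K →₀ R) :
    map R f (boundary R c) = boundary R (map R f c) := by
  have : map R f ∘ₗ boundary R = boundary R ∘ₗ map R f := by
    ext l : 2
    simp only [LinearMap.comp_apply, lsingle_apply, map_single]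
    induction l with
    | nil => simp
    | cons a l ih => simp [boundary_single_cons, map_cone, ih]
  exact LinearMap.congr_fun this c

/-! ### Barycentric subdivision -/

variable (b : K → List K → K)

/-- Barycentric subdivision of the chains of lists of length `n`, with `b a l` the barycentre
of `a :: l`. -/
noncomputable def sdAux : ℕ → (List K →₀ R) →ₗ[R] (List K →₀ R)
  -- The index only bounds the recursion; for lists of length `n` it is large enough. The identities
  -- below hold on all chains, whatever the lengths.
  | 0 => LinearMap.id
  | n + 1 => linearCombination R fun l => match l with
    | [] => single [] 1
    | a :: l => cone R (b a l) (sdAux n (boundary R (single (a :: l) 1)))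

/-- The chain homotopy between the identity and barycentric subdivision on chains of lists of
length `n`. -/
noncomputable def sdHomotopyAux : ℕ → (List K →₀ R) →ₗ[R] (List K →₀ R)
  | 0 => 0
  | n + 1 => linearCombination R fun l => match l with
    | [] => 0
    | a :: l => cone R (b a l)
        (single (a :: l) 1 - sdHomotopyAux n (boundary R (single (a :: l) 1)))

theorem boundary_sdAux (n : ℕ) (c : List K →₀ R) :
    boundary R (sdAux R b (n + 1) c) = sdAux R b n (boundary R c) := by
  have : boundary R ∘ₗ sdAux R b (n + 1) = sdAux R b n ∘ₗ boundary R := by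
    induction n with
    | zero =>
      ext l : 2
      cases l <;> simp [sdAux, boundary_cone, boundary_boundary]
    | succ n ih =>
      have h : ∀ d, boundary R (sdAux R b (n + 1) d) = sdAux R b n (boundary R d) := fun d =>
        LinearMap.congr_fun ih d
      ext l : 2
      rcases l with _ | ⟨a, l⟩
      · simp [sdAux]
      · simp only [LinearMap.comp_apply, lsingle_apply]
        rw [sdAux]
        simp [boundary_cone, h, boundary_boundary]
  exact LinearMap.congr_fun this c

/-- With `T x = b·(x - T∂x)`, the cone identity gives `∂T x = x - T∂x - b·∂(x - T∂x)`. Inductively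
`∂(x - T∂x) = sd ∂x`, and `b·sd ∂x = sd x`. -/
theorem boundary_sdHomotopyAux (n : ℕ) (c : List K →₀ R) :
    boundary R (sdHomotopyAux R b (n + 1) c) + sdHomotopyAux R b n (boundary R c)
      = c - sdAux R b (n + 1) c := by
  have : boundary R ∘ₗ sdHomotopyAux R b (n + 1) + sdHomotopyAux R b n ∘ₗ boundary R
      = LinearMap.id - sdAux R b (n + 1) := by
    induction n with
    | zero =>
      ext l : 2
      rcases l with _ | ⟨a, l⟩
      · simp [sdAux, sdHomotopyAux]
      · simp [sdAux, sdHomotopyAux, boundary_single_cons R (b a l)]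
    | succ n ih =>
      have h : ∀ d, boundary R (sdHomotopyAux R b (n + 1) d) + sdHomotopyAux R b n (boundary R d)
          = d - sdAux R b (n + 1) d := fun d =>
        LinearMap.congr_fun ih d
      ext l : 2
      rcases l with _ | ⟨a, l⟩
      · simp [sdAux, sdHomotopyAux]
      · have h' := h (boundary R (single (a :: l) 1))
        rw [boundary_boundary, map_zero, add_zero] at h'
        simp only [LinearMap.comp_apply, lsingle_apply, LinearMap.add_apply, LinearMap.sub_apply,
          LinearMap.id_apply]
        rw [sdHomotopyAux, sdAux]
        simp only [linearCombination_single, one_smul]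
        rw [boundary_cone, map_sub (boundary R), h', sub_sub_cancel]
        abel
  exact LinearMap.congr_fun this c

/-- Naturality under maps preserving barycentres is what allows subdivision to be defined on the
standard simplex and carried to singular simplices. -/
theorem map_sdAux (f : K → K') (b' : K' → List K' → K') (hb : ∀ a l, f (b a l) = b' (f a) (l.map f)) (n : ℕ)
    (c : List K →₀ R) : map R f (sdAux R b n c) = sdAux R b' n (map R f c) := by
  have : map R f ∘ₗ sdAux R b n = sdAux R b' n ∘ₗ map R f := by
    induction n with
    | zero =>
      ext l : 2
      simp [sdAux]
    | succ n ih =>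
      have h : ∀ d, map R f (sdAux R b n d) = sdAux R b' n (map R f d) := fun d =>
        LinearMap.congr_fun ih d
      ext l : 2
      rcases l with _ | ⟨a, l⟩
      · simp [sdAux]
      · simp [sdAux, map_cone, h, map_boundary, hb]
  exact LinearMap.congr_fun this c

theorem map_sdHomotopyAux (f : K → K') (b' : K' → List K' → K')
    (hb : ∀ a l, f (b a l) = b' (f a) (l.map f)) (n : ℕ) (c : List K →₀ R) :
    map R f (sdHomotopyAux R b n c) = sdHomotopyAux R b' n (map R f c) := by
  have : map R f ∘ₗ sdHomotopyAux R b n = sdHomotopyAux R b' n ∘ₗ map R f := by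
    induction n with
    | zero =>
      ext l : 2
      simp [sdHomotopyAux]
    | succ n ih =>
      have h : ∀ d, map R f (sdHomotopyAux R b n d) = sdHomotopyAux R b' n (map R f d) := fun d =>
        LinearMap.congr_fun ih d
      ext l : 2
      rcases l with _ | ⟨a, l⟩
      · simp [sdHomotopyAux]
      · simp [sdHomotopyAux, map_cone, h, map_boundary, hb]
  exact LinearMap.congr_fun this c

/-- Barycentric subdivision. -/
noncomputable def sd : (List K →₀ R) →ₗ[R] (List K →₀ R) :=
  linearCombination R fun l => sdAux R b l.length (single l 1)

/-- The chain homotopy between the identity and barycentric subdivision. -/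
noncomputable def sdHomotopy : (List K →₀ R) →ₗ[R] (List K →₀ R) :=
  linearCombination R fun l => sdHomotopyAux R b l.length (single l 1)

/-- The chains of lists of length `n`. -/
noncomputable def homogeneous (K : Type*) (n : ℕ) : Submodule R (List K →₀ R) :=
  supported R R {l | l.length = n}

variable {R} in
theorem cone_mem_homogeneous (a : K) {n : ℕ} {c : List K →₀ R} (hc : c ∈ homogeneous R K n) :
    cone R a c ∈ homogeneous R K (n + 1) := by
  have : homogeneous R K n ≤ (homogeneous R K (n + 1)).comap (cone R a) := by
    rw [homogeneous, supported_eq_span_single, Submodule.span_le]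
    rintro _ ⟨l, hl, rfl⟩
    simpa [homogeneous] using single_mem_supported R 1 (by simpa using hl)
  exact this hc

theorem boundary_single_mem_homogeneous (a : K) (l : List K) :
    boundary R (single (a :: l) 1) ∈ homogeneous R K l.length := by
  induction l generalizing a with
  | nil => simp [boundary_single_cons, homogeneous, single_mem_supported]
  | cons a' l ih =>
    rw [boundary_single_cons]
    exact Submodule.sub_mem _ (single_mem_supported R 1 rfl) (cone_mem_homogeneous a (ih a'))

theorem sd_eq_sdAux {n : ℕ} {c : List K →₀ R} (hc : c ∈ homogeneous R K n) :
    sd R b c = sdAux R b n c := by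
  have : homogeneous R K n ≤ LinearMap.eqLocus (sd R b) (sdAux R b n) := by
    rw [homogeneous, supported_eq_span_single, Submodule.span_le]
    rintro _ ⟨l, rfl, rfl⟩
    simp [sd]
  exact this hc

theorem sdHomotopy_eq_sdHomotopyAux {n : ℕ} {c : List K →₀ R} (hc : c ∈ homogeneous R K n) :
    sdHomotopy R b c = sdHomotopyAux R b n c := by
  have : homogeneous R K n ≤ LinearMap.eqLocus (sdHomotopy R b) (sdHomotopyAux R b n) := by
    rw [homogeneous, supported_eq_span_single, Submodule.span_le]
    rintro _ ⟨l, rfl, rfl⟩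
    simp [sdHomotopy]
  exact this hc

theorem sd_nil : sd R b (single [] 1) = single [] 1 := by simp [sd, sdAux]

theorem sd_single_cons (a : K) (l : List K) :
    sd R b (single (a :: l) 1)
      = cone R (b a l) (sd R b (boundary R (single (a :: l) 1))) := by
  rw [sd_eq_sdAux R b (boundary_single_mem_homogeneous R a l)]
  simp [sd, sdAux]

theorem boundary_sd (c : List K →₀ R) : boundary R (sd R b c) = sd R b (boundary R c) := by
  have : boundary R ∘ₗ sd R b = sd R b ∘ₗ boundary R := by
    ext l : 2
    rcases l with _ | ⟨a, l⟩
    · simp [sd, sdAux]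
    · simp only [LinearMap.comp_apply, lsingle_apply]
      rw [sd_eq_sdAux R b (boundary_single_mem_homogeneous R a l), ← boundary_sdAux]
      simp [sd]
  exact LinearMap.congr_fun this c

theorem boundary_sdHomotopy (c : List K →₀ R) :
    boundary R (sdHomotopy R b c) + sdHomotopy R b (boundary R c) = c - sd R b c := by
  have : boundary R ∘ₗ sdHomotopy R b + sdHomotopy R b ∘ₗ boundary R
      = LinearMap.id - sd R b := by
    ext l : 2
    rcases l with _ | ⟨a, l⟩
    · simp [sd, sdAux, sdHomotopy, sdHomotopyAux]
    · simp only [LinearMap.comp_apply, lsingle_apply, LinearMap.add_apply, LinearMap.sub_apply,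
        LinearMap.id_apply]
      rw [sdHomotopy_eq_sdHomotopyAux R b (boundary_single_mem_homogeneous R a l)]
      simpa [sd, sdHomotopy] using boundary_sdHomotopyAux R b l.length (single (a :: l) 1)
  exact LinearMap.congr_fun this c

theorem map_sd (f : K → K') (b' : K' → List K' → K') (hb : ∀ a l, f (b a l) = b' (f a) (l.map f))
    (c : List K →₀ R) : map R f (sd R b c) = sd R b' (map R f c) := by
  have : map R f ∘ₗ sd R b = sd R b' ∘ₗ map R f := by
    ext l : 2
    simp [sd, map_sdAux R b f b' hb]
  exact LinearMap.congr_fun this c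

theorem map_sdHomotopy (f : K → K') (b' : K' → List K' → K') (hb : ∀ a l, f (b a l) = b' (f a) (l.map f))
    (c : List K →₀ R) : map R f (sdHomotopy R b c) = sdHomotopy R b' (map R f c) := by
  have : map R f ∘ₗ sdHomotopy R b = sdHomotopy R b' ∘ₗ map R f := by
    ext l : 2
    simp [sdHomotopy, map_sdHomotopyAux R b f b' hb]
  exact LinearMap.congr_fun this c

/-! ### Prisms -/

/-- The prism between the images of a list under `f` and `g`. -/
noncomputable def prismAux (f g : K → K') : List K → (List K' →₀ R)
  | [] => 0
  | a :: l => cone R (f a) (single ((a :: l).map g) 1 - prismAux f g l)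

/-- The chain homotopy between the chain maps induced by `f` and `g`. -/
noncomputable def prism (f g : K → K') : (List K →₀ R) →ₗ[R] (List K' →₀ R) :=
  linearCombination R (prismAux R f g)

theorem prism_single_cons (f g : K → K') (a : K) (l : List K) :
    prism R f g (single (a :: l) 1)
      = cone R (f a) (single ((a :: l).map g) 1 - prism R f g (single l 1)) := by
  simp [prism, prismAux]

theorem prism_cone (f g : K → K') (a : K) (c : List K →₀ R) :
    prism R f g (cone R a c)
      = cone R (f a) (cone R (g a) (map R g c) - prism R f g c) := by
  have : prism R f g ∘ₗ cone R a
      = cone R (f a) ∘ₗ (cone R (g a) ∘ₗ map R g - prism R f g) := by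
    ext l : 2
    simp [prism_single_cons]
  exact LinearMap.congr_fun this c

theorem boundary_prism (f g : K → K') (c : List K →₀ R) :
    boundary R (prism R f g c) + prism R f g (boundary R c) = map R g c - map R f c := by
  have : boundary R ∘ₗ prism R f g + prism R f g ∘ₗ boundary R = map R g - map R f := by
    ext l : 2
    simp only [LinearMap.comp_apply, lsingle_apply, LinearMap.add_apply, LinearMap.sub_apply,
      map_single]
    induction l with
    | nil => simp [prism, prismAux]
    | cons a l ih =>
      rw [boundary_single_cons, map_sub, prism_cone, prism_single_cons, boundary_cone, map_sub,
        eq_sub_iff_add_eq.mpr ih, List.map_cons, List.map_cons, boundary_single_cons, map_boundary,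
        map_single]
      simp only [map_sub, cone_single]
      abel
  exact LinearMap.congr_fun this c

theorem map_prism {J J' : Type*} (f g : K → K') (f' g' : J → J') (p : K → J) (q : K' → J')
    (hf : ∀ a, q (f a) = f' (p a)) (hg : ∀ a, q (g a) = g' (p a)) (c : List K →₀ R) :
    map R q (prism R f g c) = prism R f' g' (map R p c) := by
  have : map R q ∘ₗ prism R f g = prism R f' g' ∘ₗ map R p := by
    ext l : 2
    simp only [LinearMap.comp_apply, lsingle_apply, map_single]
    induction l with
    | nil => simp [prism, prismAux]
    | cons a l ih =>
      rw [List.map_cons, prism_single_cons, prism_single_cons, map_cone, map_sub, ih]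
      simp [hf, hg, Function.comp_def]
  exact LinearMap.congr_fun this c

end ListChain

/-! ## Spaces with convex combinations -/

/-- A topological space with continuous convex combinations of finitely many points. -/
class ConvexCombSpace (K : Type*) [TopologicalSpace K] where
  /-- The affine simplex with the given vertices. -/
  comb {n : ℕ} (v : Fin n → K) : C(stdSimplex ℝ (Fin n), K)
  comb_vertex {n : ℕ} (v : Fin n → K) (i : Fin n) : comb v (stdSimplex.vertex i) = v i
  comb_comb {n k : ℕ} (v : Fin n → K) (w : Fin k → stdSimplex ℝ (Fin n))
    (t : stdSimplex ℝ (Fin k)) (s : stdSimplex ℝ (Fin n)) (h : ∀ i, s i = ∑ j, t j * w j i) :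
    comb (fun j => comb v (w j)) t = comb v s

namespace ConvexCombSpace

/-- Convex sets have convex combinations. -/
@[reducible]
def ofConvex {V : Type*} [AddCommGroup V] [Module ℝ V] [TopologicalSpace V] [ContinuousAdd V]
    [ContinuousSMul ℝ V] {s : Set V} (hs : Convex ℝ s) : ConvexCombSpace s where
  comb {n} v :=
    { toFun := fun t => ⟨∑ i, t i • (v i : V),
        hs.sum_mem (fun i _ => t.2.1 i) t.2.2 fun i _ => (v i).2⟩
      continuous_toFun := by
        refine Continuous.subtype_mk (continuous_finsetSum _ fun i _ => ?_) _
        exact ((continuous_apply i).comp continuous_subtype_val).smul continuous_const }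
  comb_vertex v i := by
    ext
    simp [stdSimplex.vertex_coe, Pi.single_apply]
  comb_comb {n k} v w t s h := by
    ext
    simp only [ContinuousMap.coe_mk, Finset.smul_sum, smul_smul, h, Finset.sum_smul]
    exact Finset.sum_comm

/-- Standard simplices serve subdivision, their products with the unit interval serve prisms, and
the one-point space serves constant maps. -/
instance (n : ℕ) : ConvexCombSpace (stdSimplex ℝ (Fin n)) := ofConvex (convex_stdSimplex ℝ (Fin n))

instance : ConvexCombSpace unitInterval := ofConvex (convex_Icc (0 : ℝ) 1)

instance : ConvexCombSpace PUnit where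
  comb _ := ContinuousMap.const _ PUnit.unit
  comb_vertex _ _ := rfl
  comb_comb _ _ _ _ _ := rfl

instance {K K' : Type*} [TopologicalSpace K] [TopologicalSpace K'] [ConvexCombSpace K]
    [ConvexCombSpace K'] : ConvexCombSpace (K × K') where
  comb v := (comb fun i => (v i).1).prodMk (comb fun i => (v i).2)
  comb_vertex v i := by simp [comb_vertex]
  comb_comb v w t s h := Prod.ext (comb_comb (fun i => (v i).1) w t s h)
    (comb_comb (fun i => (v i).2) w t s h)

theorem stdSimplex_comb_apply {n k : ℕ} (v : Fin k → stdSimplex ℝ (Fin n))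
    (t : stdSimplex ℝ (Fin k)) (i : Fin n) : comb v t i = ∑ j, t j * v j i := by
  change (∑ j, t j • (v j : Fin n → ℝ)) i = _
  simp [Finset.sum_apply]

theorem comb_stdSimplex_vertex (n : ℕ) :
    comb (stdSimplex.vertex : Fin n → stdSimplex ℝ (Fin n)) = ContinuousMap.id _ := by
  ext t i
  change comb stdSimplex.vertex t i = t i
  rw [stdSimplex_comb_apply]
  simp [Pi.single_apply]

/-- Maps compatible with convex combinations. -/
def IsAffine {K K' : Type*} [TopologicalSpace K] [TopologicalSpace K'] [ConvexCombSpace K]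
    [ConvexCombSpace K'] (f : C(K, K')) : Prop :=
  ∀ ⦃n : ℕ⦄ (v : Fin n → K), f.comp (comb v) = comb (f ∘ v)

variable {K K' : Type*} [TopologicalSpace K] [TopologicalSpace K'] [ConvexCombSpace K]
    [ConvexCombSpace K']

theorem isAffine_comb {n : ℕ} (v : Fin n → K) : IsAffine (comb v) := by
  intro k w
  ext t
  exact (comb_comb v w t _ fun i => stdSimplex_comb_apply w t i).symm

theorem IsAffine.prodMap_id {f : C(K, K')} (hf : IsAffine f) (J : Type*) [TopologicalSpace J]
    [ConvexCombSpace J] : IsAffine (f.prodMap (ContinuousMap.id J)) := by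
  intro n v
  ext t
  · exact congr($(hf fun i => (v i).1) t)
  · rfl

theorem isAffine_const : IsAffine (ContinuousMap.const K PUnit.unit) := fun _ _ => rfl

theorem equivSigmaTuple_map {α β : Type*} (f : α → β) (l : List α) :
    List.equivSigmaTuple (l.map f)
      = ⟨(List.equivSigmaTuple l).1, f ∘ (List.equivSigmaTuple l).2⟩ := by
  rw [← Equiv.eq_symm_apply]
  obtain ⟨p, rfl⟩ := List.equivSigmaTuple.symm.surjective l
  rw [Equiv.apply_symm_apply]
  exact List.map_ofFn

theorem equivSigmaTuple_ofFn {α : Type*} {n : ℕ} (v : Fin n → α) :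
    List.equivSigmaTuple (List.ofFn v) = ⟨n, v⟩ :=
  (Equiv.eq_symm_apply List.equivSigmaTuple).mp rfl

/-- The barycentre of a point and a tuple of points. -/
noncomputable def tupleBary (a : K) (p : Σ n, Fin n → K) : K :=
  comb (Fin.cons a p.2 : Fin (p.1 + 1) → K) stdSimplex.barycenter

/-- The barycentre of the list `a :: l`. -/
noncomputable def bary (a : K) (l : List K) : K := tupleBary a (List.equivSigmaTuple l)

theorem IsAffine.map_bary {f : C(K, K')} (hf : IsAffine f) (a : K) (l : List K) :
    f (bary a l) = bary (f a) (l.map f) := by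
  rw [bary, bary, equivSigmaTuple_map, tupleBary, tupleBary, ← Fin.comp_cons]
  exact congr($(hf _) _)

end ConvexCombSpace

/-! ## Singular chains -/

/-- Singular simplices; `⟨n, σ⟩` is a simplex with `n` vertices, the empty simplex included. -/
abbrev SingularSimplex (X : Type*) [TopologicalSpace X] : Type _ :=
  Σ n : ℕ, C(stdSimplex ℝ (Fin n), X)

/-- Singular chains of all dimensions. -/
abbrev SingularChain (R X : Type*) [CommRing R] [TopologicalSpace X] : Type _ :=
  SingularSimplex X →₀ R

namespace SingularChain

open Finsupp ConvexCombSpace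

variable (R : Type*) [CommRing R] {K K' X Y : Type*} [TopologicalSpace K] [TopologicalSpace K']
  [ConvexCombSpace K] [ConvexCombSpace K'] [TopologicalSpace X] [TopologicalSpace Y]

/-- The image under `τ` of the affine simplex with the given list of vertices. -/
def simplex (τ : C(K, X)) (l : List K) : SingularSimplex X :=
  ⟨(List.equivSigmaTuple l).1, τ.comp (comb (List.equivSigmaTuple l).2)⟩

/-- The image under `τ` of a chain of affine simplices. -/
noncomputable def push (τ : C(K, X)) : (List K →₀ R) →ₗ[R] SingularChain R X :=
  lmapDomain R R (simplex τ)

variable {R} in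
@[simp]
theorem push_single (τ : C(K, X)) (l : List K) (r : R) :
    push R τ (single l r) = single (simplex τ l) r := mapDomain_single

theorem simplex_map (τ : C(K', X)) {f : C(K, K')} (hf : IsAffine f) (l : List K) :
    simplex τ (l.map f) = simplex (τ.comp f) l := by
  rw [simplex, equivSigmaTuple_map, simplex, ContinuousMap.comp_assoc, hf]

theorem push_map (τ : C(K', X)) {f : C(K, K')} (hf : IsAffine f) (c : List K →₀ R) :
    push R τ (ListChain.map R f c) = push R (τ.comp f) c := by
  have : push R τ ∘ₗ ListChain.map R f = push R (τ.comp f) := by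
    ext l : 2
    simp [simplex_map τ hf]
  exact LinearMap.congr_fun this c

/-- The vertices of the standard simplex. -/
noncomputable def vertices (n : ℕ) : List (stdSimplex ℝ (Fin n)) := List.ofFn stdSimplex.vertex

theorem simplex_vertices {n : ℕ} (σ : C(stdSimplex ℝ (Fin n), X)) :
    simplex σ (vertices n) = ⟨n, σ⟩ := by
  rw [simplex, vertices, equivSigmaTuple_ofFn, comb_stdSimplex_vertex, ContinuousMap.comp_id]

theorem push_vertices {n : ℕ} (σ : C(stdSimplex ℝ (Fin n), X)) :
    push R σ (single (vertices n) 1) = single ⟨n, σ⟩ 1 := by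
  rw [push_single, simplex_vertices]

theorem map_comb_vertices {n : ℕ} (v : Fin n → K) : (vertices n).map (comb v) = List.ofFn v := by
  rw [vertices, List.map_ofFn]
  congr 1
  ext i
  exact comb_vertex v i

theorem ofFn_equivSigmaTuple {α : Type*} (l : List α) :
    List.ofFn (List.equivSigmaTuple l).2 = l := List.equivSigmaTuple.symm_apply_apply l

/-- The operation on singular chains given by an operation on chains of affine simplices. -/
noncomputable def extend (Θ : ∀ n, (List (stdSimplex ℝ (Fin n)) →₀ R) →ₗ[R]
    (List (stdSimplex ℝ (Fin n)) →₀ R)) : SingularChain R X →ₗ[R] SingularChain R X :=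
  linearCombination R fun σ => push R σ.2 (Θ σ.1 (single (vertices σ.1) 1))

/-- An operation natural under affine maps is determined by its value on the list of vertices of the
standard simplex. Every identity between list chains thus passes to singular chains. -/
theorem extend_push (Θ : ∀ n, (List (stdSimplex ℝ (Fin n)) →₀ R) →ₗ[R]
    (List (stdSimplex ℝ (Fin n)) →₀ R)) (Θ' : (List K →₀ R) →ₗ[R] (List K →₀ R))
    (h : ∀ n (f : C(stdSimplex ℝ (Fin n), K)), IsAffine f → ∀ c,
      ListChain.map R f (Θ n c) = Θ' (ListChain.map R f c))
    (τ : C(K, X)) (c : List K →₀ R) : extend R Θ (push R τ c) = push R τ (Θ' c) := by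
  have : extend R Θ ∘ₗ push R τ = push R τ ∘ₗ Θ' := by
    ext l : 2
    simp only [LinearMap.comp_apply, lsingle_apply, push_single, extend, simplex,
      linearCombination_single, one_smul]
    rw [← push_map R τ (isAffine_comb _), h _ _ (isAffine_comb _), ListChain.map_single,
      map_comb_vertices, ofFn_equivSigmaTuple]
  exact LinearMap.congr_fun this c

/-- Two linear maps agree if they agree on pushed forward affine simplices. -/
theorem hom_ext {M : Type*} [AddCommGroup M] [Module R M] {f g : SingularChain R X →ₗ[R] M}
    (h : ∀ n (σ : C(stdSimplex ℝ (Fin n), X)),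
      f (push R σ (single (vertices n) 1)) = g (push R σ (single (vertices n) 1))) : f = g := by
  ext ⟨n, σ⟩
  have h' := h n σ
  rw [push_vertices] at h'
  exact h'

/-- The boundary of singular chains, augmented by the empty simplex. -/
noncomputable def boundary : SingularChain R X →ₗ[R] SingularChain R X :=
  extend R fun _ => ListChain.boundary R

theorem boundary_push (τ : C(K, X)) (c : List K →₀ R) :
    boundary R (push R τ c) = push R τ (ListChain.boundary R c) :=
  extend_push R _ _ (fun _ f _ c => ListChain.map_boundary R f c) τ c

theorem boundary_boundary (c : SingularChain R X) : boundary R (boundary R c) = 0 := by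
  have : boundary R ∘ₗ boundary R = (0 : SingularChain R X →ₗ[R] _) :=
    hom_ext R fun n σ => by
      simp only [LinearMap.comp_apply, boundary_push, ListChain.boundary_boundary, map_zero,
        LinearMap.zero_apply]
  exact LinearMap.congr_fun this c

/-- Barycentric subdivision of singular chains. -/
noncomputable def sd : SingularChain R X →ₗ[R] SingularChain R X :=
  extend R fun _ => ListChain.sd R bary

theorem sd_push (τ : C(K, X)) (c : List K →₀ R) :
    sd R (push R τ c) = push R τ (ListChain.sd R bary c) :=
  extend_push R _ _ (fun _ f hf c => ListChain.map_sd R bary f bary hf.map_bary c) τ c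

/-- The chain homotopy between the identity and barycentric subdivision. -/
noncomputable def sdHomotopy : SingularChain R X →ₗ[R] SingularChain R X :=
  extend R fun _ => ListChain.sdHomotopy R bary

theorem sdHomotopy_push (τ : C(K, X)) (c : List K →₀ R) :
    sdHomotopy R (push R τ c) = push R τ (ListChain.sdHomotopy R bary c) :=
  extend_push R _ _ (fun _ f hf c => ListChain.map_sdHomotopy R bary f bary hf.map_bary c) τ c

theorem boundary_sd (c : SingularChain R X) : boundary R (sd R c) = sd R (boundary R c) := by
  have : boundary R ∘ₗ sd R = sd R ∘ₗ (boundary R : SingularChain R X →ₗ[R] _) :=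
    hom_ext R fun n σ => by simp only [LinearMap.comp_apply, sd_push, boundary_push,
      ListChain.boundary_sd]
  exact LinearMap.congr_fun this c

theorem boundary_sdHomotopy (c : SingularChain R X) :
    boundary R (sdHomotopy R c) + sdHomotopy R (boundary R c) = c - sd R c := by
  have : boundary R ∘ₗ sdHomotopy R + sdHomotopy R ∘ₗ boundary R
      = LinearMap.id - (sd R : SingularChain R X →ₗ[R] _) :=
    hom_ext R fun n σ => by
      simp only [LinearMap.comp_apply, LinearMap.add_apply, LinearMap.sub_apply,
        LinearMap.id_apply, sd_push, sdHomotopy_push, boundary_push, ← map_add, ← map_sub,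
        ListChain.boundary_sdHomotopy]
  exact LinearMap.congr_fun this c

/-- The chain map induced by a continuous map. -/
noncomputable def map (f : C(X, Y)) : SingularChain R X →ₗ[R] SingularChain R Y :=
  lmapDomain R R fun σ => ⟨σ.1, f.comp σ.2⟩

variable {R} in
@[simp]
theorem map_single (f : C(X, Y)) (σ : SingularSimplex X) (r : R) :
    map R f (single σ r) = single ⟨σ.1, f.comp σ.2⟩ r := mapDomain_single

theorem map_push (f : C(X, Y)) (τ : C(K, X)) (c : List K →₀ R) :
    map R f (push R τ c) = push R (f.comp τ) c := by
  have : map R f ∘ₗ push R τ = push R (f.comp τ) := by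
    ext l : 2
    simp [simplex, ContinuousMap.comp_assoc]
  exact LinearMap.congr_fun this c

theorem map_boundary (f : C(X, Y)) (c : SingularChain R X) :
    map R f (boundary R c) = boundary R (map R f c) := by
  have : map R f ∘ₗ boundary R = boundary R ∘ₗ map R f :=
    hom_ext R fun n σ => by simp only [LinearMap.comp_apply, map_push, boundary_push]
  exact LinearMap.congr_fun this c

theorem map_map {Z : Type*} [TopologicalSpace Z] (g : C(Y, Z)) (f : C(X, Y))
    (c : SingularChain R X) : map R g (map R f c) = map R (g.comp f) c := by
  have : map R g ∘ₗ map R f = map R (g.comp f) := by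
    ext σ : 2
    simp [ContinuousMap.comp_assoc]
  exact LinearMap.congr_fun this c

theorem map_id (c : SingularChain R X) : map R (ContinuousMap.id X) c = c := by
  have : map R (ContinuousMap.id X) = LinearMap.id := by
    ext σ : 2
    simp
  exact LinearMap.congr_fun this c

/-! ### Homotopies of maps and singular chains -/

/-- The chain homotopy given by a homotopy. -/
noncomputable def prism (H : C(X × unitInterval, Y)) :
    SingularChain R X →ₗ[R] SingularChain R Y :=
  linearCombination R fun σ =>
    push R (H.comp (σ.2.prodMap (ContinuousMap.id _)))
      (ListChain.prism R (fun a => (a, 0)) (fun a => (a, 1)) (single (vertices σ.1) 1))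

theorem prism_push (H : C(X × unitInterval, Y)) (τ : C(K, X)) (c : List K →₀ R) :
    prism R H (push R τ c) = push R (H.comp (τ.prodMap (ContinuousMap.id _)))
      (ListChain.prism R (fun a => (a, 0)) (fun a => (a, 1)) c) := by
  have : prism R H ∘ₗ push R τ = push R (H.comp (τ.prodMap (ContinuousMap.id _))) ∘ₗ
      ListChain.prism R (fun a => (a, 0)) (fun a => (a, 1)) := by
    ext l : 2
    simp only [LinearMap.comp_apply, lsingle_apply, push_single, prism, simplex,
      linearCombination_single, one_smul]
    conv_rhs => rw [← ofFn_equivSigmaTuple l, ← map_comb_vertices, ← ListChain.map_single,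
      ← ListChain.map_prism R (fun a => (a, (0 : unitInterval))) (fun a => (a, 1)) _ _ (comb (List.equivSigmaTuple l).2)
        ((comb (List.equivSigmaTuple l).2).prodMap (ContinuousMap.id unitInterval))
        (fun _ => rfl) (fun _ => rfl),
      push_map R _ ((isAffine_comb _).prodMap_id unitInterval)]
    rfl
  exact LinearMap.congr_fun this c

theorem boundary_prism (H : C(X × unitInterval, Y)) (f g : C(X, Y)) (hf : ∀ x, H (x, 0) = f x)
    (hg : ∀ x, H (x, 1) = g x) (c : SingularChain R X) :
    boundary R (prism R H c) + prism R H (boundary R c) = map R g c - map R f c := by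
  -- The inclusions of the two ends of the prism are affine because barycentric weights sum to one.
  have affine (t : unitInterval) (n : ℕ) : IsAffine
      ((ContinuousMap.id (stdSimplex ℝ (Fin n))).prodMk (ContinuousMap.const _ t)) := by
    intro k v
    ext s : 2
    · rfl
    · apply Subtype.ext
      change (t : ℝ) = ∑ i, s i • (t : ℝ)
      rw [← Finset.sum_smul, stdSimplex.sum_eq_one, one_smul]
  have : boundary R ∘ₗ prism R H + prism R H ∘ₗ boundary R = map R g - map R f :=
    hom_ext R fun n σ => by
      simp only [LinearMap.comp_apply, LinearMap.add_apply, LinearMap.sub_apply, prism_push,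
        boundary_push, ← map_add, ListChain.boundary_prism, map_push]
      rw [map_sub]
      congr 1
      · refine (push_map R _ (affine 1 n) _).trans ?_
        congr 2
        ext x
        exact hg _
      · refine (push_map R _ (affine 0 n) _).trans ?_
        congr 2
        ext x
        exact hf _
  exact LinearMap.congr_fun this c

/-! ### Chains in a subset -/

/-- The chains of simplices with range in `U`. -/
noncomputable def chainsIn (U : Set X) : Submodule R (SingularChain R X) :=
  supported R R {σ | Set.range σ.2 ⊆ U}

/-- The chains of simplices with `n` vertices. -/
noncomputable def homogeneous (X : Type*) [TopologicalSpace X] (n : ℕ) :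
    Submodule R (SingularChain R X) :=
  supported R R {σ | σ.1 = n}

variable {R}

theorem map_mem_of_single {M : Type*} [AddCommGroup M] [Module R M] {ι : Type*} {s : Set ι}
    (f : (ι →₀ R) →ₗ[R] M) {p : Submodule R M} (h : ∀ i ∈ s, f (single i 1) ∈ p) {c : ι →₀ R}
    (hc : c ∈ supported R R s) : f c ∈ p := by
  have : supported R R s ≤ p.comap f := by
    rw [supported_eq_span_single, Submodule.span_le]
    rintro _ ⟨i, hi, rfl⟩
    exact h i hi
  exact this hc

theorem push_mem_chainsIn {U : Set X} {τ : C(K, X)} (h : Set.range τ ⊆ U) (c : List K →₀ R) :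
    push R τ c ∈ chainsIn R U :=
  map_mem_of_single (s := Set.univ) _ (fun l _ => by
    rw [push_single]
    refine single_mem_supported R 1 ?_
    rintro _ ⟨x, rfl⟩
    exact h ⟨_, rfl⟩) (by simp)

/-- Every simplex produced from `σ` factors through `σ`, so ranges only shrink. -/
theorem extend_mem_chainsIn {U : Set X} (Θ : ∀ n, (List (stdSimplex ℝ (Fin n)) →₀ R) →ₗ[R]
    (List (stdSimplex ℝ (Fin n)) →₀ R)) {c : SingularChain R X} (hc : c ∈ chainsIn R U) :
    extend R Θ c ∈ chainsIn R U :=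
  map_mem_of_single _ (fun σ hσ => by
    simpa [extend] using push_mem_chainsIn hσ _) hc

theorem boundary_mem_chainsIn {U : Set X} {c : SingularChain R X} (hc : c ∈ chainsIn R U) :
    boundary R c ∈ chainsIn R U := extend_mem_chainsIn _ hc

theorem sd_mem_chainsIn {U : Set X} {c : SingularChain R X} (hc : c ∈ chainsIn R U) :
    sd R c ∈ chainsIn R U := extend_mem_chainsIn _ hc

theorem sdHomotopy_mem_chainsIn {U : Set X} {c : SingularChain R X} (hc : c ∈ chainsIn R U) :
    sdHomotopy R c ∈ chainsIn R U := extend_mem_chainsIn _ hc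

theorem map_mem_chainsIn {U : Set X} {V : Set Y} {f : C(X, Y)} (h : Set.MapsTo f U V)
    {c : SingularChain R X} (hc : c ∈ chainsIn R U) : map R f c ∈ chainsIn R V :=
  map_mem_of_single _ (fun σ hσ => by
    rw [map_single]
    refine single_mem_supported R 1 ?_
    rintro _ ⟨x, rfl⟩
    exact h (hσ ⟨x, rfl⟩)) hc

theorem prism_mem_chainsIn {U : Set X} {V : Set Y} {H : C(X × unitInterval, Y)}
    (h : ∀ x ∈ U, ∀ t, H (x, t) ∈ V) {c : SingularChain R X} (hc : c ∈ chainsIn R U) :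
    prism R H c ∈ chainsIn R V :=
  map_mem_of_single _ (fun σ hσ => by
    simp only [prism, linearCombination_single, one_smul]
    refine push_mem_chainsIn ?_ _
    rintro _ ⟨x, rfl⟩
    exact h _ (hσ ⟨x.1, rfl⟩) _) hc

theorem map_mem_homogeneous {n : ℕ} (f : C(X, Y)) {c : SingularChain R X}
    (hc : c ∈ homogeneous R X n) : map R f c ∈ homogeneous R Y n :=
  map_mem_of_single _ (fun σ hσ => by
    rw [map_single]
    exact single_mem_supported R 1 hσ) hc

theorem push_mem_homogeneous {n : ℕ} (τ : C(K, X)) {c : List K →₀ R}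
    (hc : c ∈ ListChain.homogeneous R K n) : push R τ c ∈ homogeneous R X n :=
  map_mem_of_single _ (fun l hl => by
    rw [push_single]
    refine single_mem_supported R 1 ?_
    have : l.length = n := hl
    rw [← this]
    exact (congrArg List.length (ofFn_equivSigmaTuple l)).symm.trans (List.length_ofFn) |>.symm) hc

theorem boundary_mem_homogeneous {n : ℕ} {c : SingularChain R X}
    (hc : c ∈ homogeneous R X (n + 1)) : boundary R c ∈ homogeneous R X n :=
  map_mem_of_single _ (fun σ hσ => by
    obtain ⟨_, σ⟩ := σ
    obtain rfl : _ = n + 1 := hσ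
    rw [← push_vertices, boundary_push]
    refine push_mem_homogeneous _ ?_
    obtain ⟨a, l, hl⟩ : ∃ a l, vertices (n + 1) = a :: l := ⟨_, _, List.ofFn_succ⟩
    have : l.length = n := by simpa [vertices] using (congrArg List.length hl).symm
    rw [hl]
    convert ListChain.boundary_single_mem_homogeneous R a l
    exact this.symm) hc

theorem boundary_eq_zero {c : SingularChain R X} (hc : c ∈ homogeneous R X 0) :
    boundary R c = 0 := by
  rw [← Submodule.mem_bot R]
  exact map_mem_of_single _ (fun σ hσ => by
    obtain ⟨_, σ⟩ := σ
    obtain rfl : _ = 0 := hσ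
    rw [← push_vertices, boundary_push]
    simp [vertices]) hc

/-- If a homogeneous chain is a boundary, then it is the boundary of a homogeneous chain. -/
theorem exists_homogeneous_boundary {U : Set X} {n : ℕ} {z c : SingularChain R X}
    (hz : z ∈ homogeneous R X n) (hc : c ∈ chainsIn R U) (h : boundary R c = z) :
    ∃ c' ∈ chainsIn R U, c' ∈ homogeneous R X (n + 1) ∧ boundary R c' = z := by
  classical
  -- Since `∂` lowers the number of vertices by exactly one, truncation to a single degree commutes
  -- with it. Empty simplices are treated apart, their boundary being zero.
  have key (c : SingularChain R X) : (boundary R c).filter (fun σ => σ.1 = n)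
      = boundary R (c.filter fun σ => σ.1 = n + 1) := by
    induction c using Finsupp.induction_linear with
    | zero => rw [map_zero, filter_zero, filter_zero, map_zero]
    | add a b ha hb => rw [map_add, filter_add, ha, hb, ← map_add, ← filter_add]
    | single σ r =>
      by_cases hσ : σ.1 = n + 1
      · rw [filter_single_of_pos (p := fun σ : SingularSimplex X => σ.1 = n + 1) hσ,
          filter_eq_self_iff]
        intro τ hτ
        by_contra h'
        exact hτ ((mem_supported' R _).mp
            (boundary_mem_homogeneous (single_mem_supported R r hσ)) τ h')
      · rw [filter_single_of_neg (p := fun σ : SingularSimplex X => σ.1 = n + 1) hσ, map_zero,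
          filter_eq_zero_iff]
        intro τ hτ
        by_contra h'
        rcases hk : σ.1 with _ | k
        · exact h' (by rw [boundary_eq_zero (single_mem_supported R r hk)]; rfl)
        · have := (mem_supported' R _).mp
            (boundary_mem_homogeneous (single_mem_supported R r hk)) τ
          refine h' (this fun h'' => hσ ?_)
          have : τ.1 = k := h''
          lia
  refine ⟨c.filter fun σ => σ.1 = n + 1, ?_, ?_, ?_⟩
  · exact (mem_supported R _).mpr (Set.Subset.trans (Finset.coe_subset.mpr (by
      rw [support_filter]; exact Finset.filter_subset _ _)) ((mem_supported R _).mp hc))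
  · rw [homogeneous, mem_supported, support_filter]
    intro σ hσ
    exact (Finset.mem_filter.mp hσ).2
  · rw [← key, h, filter_eq_self_iff]
    intro σ hσ
    by_contra h'
    exact hσ ((mem_supported' R _).mp hz σ h')

end SingularChain

/-! ## Small chains -/

namespace ConvexCombSpace

variable {n : ℕ}

theorem coe_comb {k : ℕ} (v : Fin k → stdSimplex ℝ (Fin n)) (t : stdSimplex ℝ (Fin k)) :
    (comb v t : Fin n → ℝ) = ∑ i, t i • (v i : Fin n → ℝ) := rfl

theorem dist_comb_le {k : ℕ} {v : Fin k → stdSimplex ℝ (Fin n)} {c : stdSimplex ℝ (Fin n)} {r : ℝ}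
    (h : ∀ i, dist (v i) c ≤ r) (t : stdSimplex ℝ (Fin k)) : dist (comb v t) c ≤ r := by
  have := (convex_closedBall (c : Fin n → ℝ) r).sum_mem (t := Finset.univ) (fun i _ => t.2.1 i)
    t.2.2 (z := fun i => (v i : Fin n → ℝ)) fun i _ => h i
  exact this

/-- The barycentre minus `v j` is the sum of the `k` vectors `(v i - v j)/(k + 1)` with `i ≠ j`, so
its norm is at most `kδ/(k + 1)`. -/
theorem dist_comb_barycenter_le {k : ℕ} {v : Fin (k + 1) → stdSimplex ℝ (Fin n)} {δ : ℝ}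
    (h : ∀ i j, dist (v i) (v j) ≤ δ) (j : Fin (k + 1)) :
    dist (comb v stdSimplex.barycenter) (v j) ≤ (1 - ((k + 1 : ℕ) : ℝ)⁻¹) * δ := by
  have hk : ((k + 1 : ℕ) : ℝ) ≠ 0 := by positivity
  have e : (comb v stdSimplex.barycenter : Fin n → ℝ) - (v j : Fin n → ℝ)
      = ∑ i ∈ Finset.univ.erase j,
        ((k + 1 : ℕ) : ℝ)⁻¹ • ((v i : Fin n → ℝ) - (v j : Fin n → ℝ)) := by
    rw [coe_comb, Finset.sum_erase _ (by simp)]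
    simp only [smul_sub, Finset.sum_sub_distrib, ← Finset.smul_sum, Finset.sum_const,
      Finset.card_univ, Fintype.card_fin, ← Nat.cast_smul_eq_nsmul ℝ, smul_smul,
      inv_mul_cancel₀ hk, one_smul]
    rw [Finset.smul_sum]
    congr 1
    refine Finset.sum_congr rfl fun i _ => ?_
    congr 1
    exact (stdSimplex.barycenter_apply i).trans (by simp)
  rw [Subtype.dist_eq, dist_eq_norm]
  refine (congrArg norm e).trans_le ?_
  refine (norm_sum_le _ _).trans ((Finset.sum_le_card_nsmul _ _
    (((k + 1 : ℕ) : ℝ)⁻¹ * δ) fun i _ => ?_).trans_eq ?_)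
  · rw [norm_smul, Real.norm_of_nonneg (by positivity), ← dist_eq_norm]
    exact mul_le_mul_of_nonneg_left (h i j) (by positivity)
  · rw [Finset.card_erase_of_mem (Finset.mem_univ _), Finset.card_univ, Fintype.card_fin,
      nsmul_eq_mul]
    push_cast
    field_simp
    ring

end ConvexCombSpace

namespace ListChain

open Finsupp ConvexCombSpace SingularChain

variable {R : Type*} [CommRing R] {n : ℕ}

theorem boundary_single_mem_subset {K : Type*} (l₀ : List K) :
    boundary R (single l₀ 1) ∈ supported R R {l | l.length + 1 = l₀.length ∧ l ⊆ l₀} := by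
  induction l₀ with
  | nil => simp
  | cons a l₀ ih =>
    rw [boundary_single_cons]
    refine Submodule.sub_mem _ (single_mem_supported R 1 (by simp)) ?_
    refine map_mem_of_single _ (fun l hl => ?_) ih
    rw [cone_single]
    refine single_mem_supported R 1 ⟨by simpa using hl.1, ?_⟩
    exact List.cons_subset_cons a hl.2

/-- Lists obtained by subdividing `l₀` once: all distances are scaled, and all balls that contain
`l₀` contain the list. -/
def subdivided (N : ℕ) (δ : ℝ) (l₀ : List (stdSimplex ℝ (Fin n))) :
    Set (List (stdSimplex ℝ (Fin n))) :=
  {l | l.length = l₀.length ∧ (∀ x ∈ l, ∀ y ∈ l, dist x y ≤ (1 - (N : ℝ)⁻¹) * δ) ∧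
    ∀ c r, (∀ x ∈ l₀, dist x c ≤ r) → ∀ x ∈ l, dist x c ≤ r}

/-- By induction on the length: the barycentre is within the reduced distance of all old vertices,
and the clause on balls passes this on to the vertices of the subdivided faces. A fixed `N` bounding
all lengths keeps the contraction ratio uniform. -/
theorem sd_single_mem_subdivided {N : ℕ} {δ : ℝ} (l₀ : List (stdSimplex ℝ (Fin n)))
    (hN : l₀.length ≤ N) (hδ : ∀ x ∈ l₀, ∀ y ∈ l₀, dist x y ≤ δ) :
    sd R bary (single l₀ 1) ∈ supported R R (subdivided N δ l₀) := by
  induction hk : l₀.length generalizing l₀ with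
  | zero =>
    obtain rfl := List.length_eq_zero_iff.mp hk
    rw [sd_nil]
    exact single_mem_supported R 1 (by simp [subdivided])
  | succ k ih =>
    obtain ⟨a, l₁, rfl⟩ := List.exists_cons_of_length_eq_add_one hk
    rw [sd_single_cons]
    have hlen : l₁.length = k := by simpa using hk
    have hδ0 : 0 ≤ δ := dist_nonneg.trans (hδ a (by simp) a (by simp))
    have hN1 : (k + 1 : ℕ) ≤ N := hk ▸ hN
    have hq : (1 - ((k + 1 : ℕ) : ℝ)⁻¹) * δ ≤ (1 - (N : ℝ)⁻¹) * δ := by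
      gcongr
    have hq0 : 0 ≤ (1 - (N : ℝ)⁻¹) * δ := by
      refine mul_nonneg (sub_nonneg.mpr (inv_le_one_of_one_le₀ ?_)) hδ0
      exact_mod_cast (by lia : 1 ≤ N)
    obtain ⟨v, hv, hb⟩ : ∃ v : Fin (k + 1) → stdSimplex ℝ (Fin n),
        (∀ x, x ∈ a :: l₁ ↔ ∃ i, v i = x) ∧ bary a l₁ = comb v stdSimplex.barycenter := by
      obtain ⟨⟨k', v⟩, rfl⟩ := List.equivSigmaTuple.symm.surjective l₁
      obtain rfl : k' = k := by
        rw [← hlen]; exact List.length_ofFn.symm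
      refine ⟨Fin.cons a v, fun x => ?_, ?_⟩
      · change x ∈ a :: List.ofFn v ↔ _
        rw [Fin.exists_fin_succ]
        simp [List.mem_ofFn, eq_comm]
      · rw [bary, Equiv.apply_symm_apply, tupleBary]
    have hdist (x) (hx : x ∈ a :: l₁) : dist x (bary a l₁) ≤ (1 - (N : ℝ)⁻¹) * δ := by
      obtain ⟨j, rfl⟩ := (hv x).mp hx
      rw [hb, dist_comm]
      refine (dist_comb_barycenter_le (fun i j => ?_) j).trans hq
      exact hδ _ ((hv _).mpr ⟨i, rfl⟩) _ ((hv _).mpr ⟨j, rfl⟩)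
    refine map_mem_of_single (cone R (bary a l₁) ∘ₗ sd R bary) (fun l hl => ?_)
      (boundary_single_mem_subset (a :: l₁))
    have hl' := ih l (by have := hl.1; lia)
      (fun x hx y hy => hδ x (hl.2 hx) y (hl.2 hy)) (by have := hl.1; simp at this; lia)
    refine map_mem_of_single (cone R (bary a l₁)) (fun l' hl' => ?_) hl'
    rw [cone_single]
    refine single_mem_supported R 1 ⟨?_, ?_, ?_⟩
    · rw [List.length_cons, hl'.1, hl.1]
    · have hx (x) (hx : x ∈ l') := hl'.2.2 _ _ (fun y hy => hdist y (hl.2 hy)) x hx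
      intro x hx' y hy'
      rcases List.mem_cons.mp hx' with rfl | hx' <;> rcases List.mem_cons.mp hy' with rfl | hy'
      · simpa using hq0
      · rw [dist_comm]; exact hx y hy'
      · exact hx x hx'
      · exact hl'.2.1 x hx' y hy'
    · intro c r h x hx
      rcases List.mem_cons.mp hx with rfl | hx
      · rw [hb]
        exact dist_comb_le (fun i => h _ ((hv _).mpr ⟨i, rfl⟩)) _
      · exact hl'.2.2 c r (fun y hy => h y (hl.2 hy)) x hx

theorem sd_iterate_single_mem {N : ℕ} {δ : ℝ} (l₀ : List (stdSimplex ℝ (Fin n)))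
    (hN : l₀.length ≤ N) (hδ : ∀ x ∈ l₀, ∀ y ∈ l₀, dist x y ≤ δ) (k : ℕ) :
    (sd R bary)^[k] (single l₀ 1) ∈ supported R R
      {l | l.length ≤ N ∧ ∀ x ∈ l, ∀ y ∈ l, dist x y ≤ (1 - (N : ℝ)⁻¹) ^ k * δ} := by
  induction k with
  | zero => exact single_mem_supported R 1 ⟨hN, by simpa using hδ⟩
  | succ k ih =>
    rw [Function.iterate_succ_apply']
    refine map_mem_of_single _ (fun l hl => ?_) ih
    refine supported_mono ?_ (sd_single_mem_subdivided l hl.1 hl.2)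
    rintro l' ⟨h₁, h₂, -⟩
    exact ⟨h₁ ▸ hl.1, fun x hx y hy => (h₂ x hx y hy).trans_eq (by rw [pow_succ']; ring)⟩

end ListChain

namespace SingularChain

open Finsupp ConvexCombSpace

variable {R : Type*} [CommRing R] {X Y : Type*} [TopologicalSpace X] [TopologicalSpace Y]

theorem sd_iterate_push {K : Type*} [TopologicalSpace K] [ConvexCombSpace K] (τ : C(K, X))
    (c : List K →₀ R) (k : ℕ) :
    (sd R)^[k] (push R τ c) = push R τ ((ListChain.sd R bary)^[k] c) := by
  induction k with
  | zero => rfl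
  | succ k ih => rw [Function.iterate_succ_apply', ih, sd_push, Function.iterate_succ_apply']

theorem sd_mem_sup {U V : Set X} {c : SingularChain R X}
    (hc : c ∈ chainsIn R U ⊔ chainsIn R V) : sd R c ∈ chainsIn R U ⊔ chainsIn R V := by
  obtain ⟨a, ha, b, hb, rfl⟩ := Submodule.mem_sup.mp hc
  rw [map_add]
  exact Submodule.add_mem_sup (sd_mem_chainsIn ha) (sd_mem_chainsIn hb)

theorem sd_iterate_mem_sup {U V : Set X} {c : SingularChain R X}
    (hc : c ∈ chainsIn R U ⊔ chainsIn R V) (k : ℕ) :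
    (sd R)^[k] c ∈ chainsIn R U ⊔ chainsIn R V := by
  induction k with
  | zero => exact hc
  | succ k ih => rw [Function.iterate_succ_apply']; exact sd_mem_sup ih

/-- Take a Lebesgue number of the cover of the simplex by the preimages of `U` and `V`. The mesh of
iterated subdivisions tends to zero, so eventually each piece lies in one of the two. -/
theorem exists_sd_iterate_single_mem_sup {U V : Set X} (hU : IsOpen U) (hV : IsOpen V)
    {σ : SingularSimplex X} (hσ : Set.range σ.2 ⊆ U ∪ V) :
    ∃ k, (sd R)^[k] (single σ 1) ∈ chainsIn R U ⊔ chainsIn R V := by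
  obtain ⟨n, σ⟩ := σ
  obtain ⟨ε, hε, h⟩ := lebesgue_number_lemma_of_metric (s := Set.univ)
    (c := fun b : Bool => σ ⁻¹' (bif b then U else V)) isCompact_univ
    (fun b => (by cases b <;> assumption : IsOpen (bif b then U else V)).preimage σ.continuous)
    (fun x _ => by
      rcases hσ ⟨x, rfl⟩ with hx | hx
      · exact Set.mem_iUnion.mpr ⟨true, hx⟩
      · exact Set.mem_iUnion.mpr ⟨false, hx⟩)
  set N := n + 1
  set δ := Metric.diam (Set.univ : Set (stdSimplex ℝ (Fin n)))
  have hq : (0 : ℝ) ≤ 1 - (N : ℝ)⁻¹ ∧ 1 - (N : ℝ)⁻¹ < 1 := by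
    constructor
    · rw [sub_nonneg]; exact inv_le_one_of_one_le₀ (by simp [N])
    · rw [sub_lt_self_iff]; positivity
  obtain ⟨k, hk⟩ : ∃ k : ℕ, (1 - (N : ℝ)⁻¹) ^ k * δ < ε := by
    have := (tendsto_pow_atTop_nhds_zero_of_lt_one hq.1 hq.2).mul_const δ
    rw [zero_mul] at this
    exact (this.eventually_lt_const hε).exists
  refine ⟨k, ?_⟩
  rw [← push_vertices, sd_iterate_push]
  refine map_mem_of_single _ (fun l hl => ?_)
    (ListChain.sd_iterate_single_mem (R := R) (vertices n) (N := N) (δ := δ) (by simp [vertices, N])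
      (fun x _ y _ => Metric.dist_le_diam_of_mem isCompact_univ.isBounded trivial trivial) k)
  rw [push_single]
  obtain ⟨⟨m, v⟩, rfl⟩ := List.equivSigmaTuple.symm.surjective l
  rw [simplex, Equiv.apply_symm_apply]
  -- The empty simplex has empty range and lies in every subset; otherwise the first vertex is the
  -- centre of a Lebesgue ball.
  rcases m with _ | m
  · refine Submodule.mem_sup_left (single_mem_supported R 1 ?_)
    rintro _ ⟨t, rfl⟩
    have := t.2.2
    simp at this
  · obtain ⟨b, hb⟩ := h (v 0) trivial
    have : Set.range (σ.comp (comb v)) ⊆ bif b then U else V := by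
      rintro _ ⟨t, rfl⟩
      refine hb ?_
      refine (dist_comb_le (fun i => hl.2 _ ?_ _ ?_) t).trans_lt hk
      · exact (List.mem_ofFn ..).mpr ⟨i, rfl⟩
      · exact (List.mem_ofFn ..).mpr ⟨0, rfl⟩
    cases b
    · exact Submodule.mem_sup_right (single_mem_supported R 1 this)
    · exact Submodule.mem_sup_left (single_mem_supported R 1 this)

theorem exists_sd_iterate_mem_sup {U V : Set X} (hU : IsOpen U) (hV : IsOpen V)
    {c : SingularChain R X} (hc : c ∈ chainsIn R (U ∪ V)) :
    ∃ k, (sd R)^[k] c ∈ chainsIn R U ⊔ chainsIn R V := by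
  have iter_add (k : ℕ) (a b : SingularChain R X) :
      (sd R)^[k] (a + b) = (sd R)^[k] a + (sd R)^[k] b := by
    simp only [← Module.End.coe_pow, map_add]
  rw [chainsIn, supported_eq_span_single] at hc
  induction hc using Submodule.span_induction with
  | mem c hc =>
    obtain ⟨σ, hσ, rfl⟩ := hc
    exact exists_sd_iterate_single_mem_sup hU hV hσ
  | zero => exact ⟨0, Submodule.zero_mem _⟩
  | add a b _ _ ha hb =>
    obtain ⟨k, hk⟩ := ha
    obtain ⟨k', hk'⟩ := hb
    -- Each summand has its own number of subdivisions, and further subdivision preserves smallness.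
    refine ⟨k + k', ?_⟩
    rw [iter_add]
    refine Submodule.add_mem _ ?_ ?_
    · rw [add_comm, Function.iterate_add_apply]
      exact sd_iterate_mem_sup hk k'
    · rw [Function.iterate_add_apply]
      exact sd_iterate_mem_sup hk' k
  | smul r a _ ha =>
    obtain ⟨k, hk⟩ := ha
    refine ⟨k, ?_⟩
    rw [← Module.End.coe_pow, map_smul, Module.End.coe_pow]
    exact Submodule.smul_mem _ r hk

/-- A cycle in `U ∪ V` is homologous to a sum of chains in `U` and `V`. -/
theorem exists_homologous_mem_sup {U V : Set X} (hU : IsOpen U) (hV : IsOpen V)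
    {z : SingularChain R X} (hz : z ∈ chainsIn R (U ∪ V)) (hz' : boundary R z = 0) :
    ∃ c ∈ chainsIn R (U ∪ V), z - boundary R c ∈ chainsIn R U ⊔ chainsIn R V := by
  obtain ⟨k, hk⟩ := exists_sd_iterate_mem_sup hU hV hz
  induction k generalizing z with
  | zero => exact ⟨0, Submodule.zero_mem _, by simpa using hk⟩
  | succ k ih =>
    obtain ⟨c, hc, h⟩ := ih (sd_mem_chainsIn hz) (by rw [boundary_sd, hz', map_zero])
      (by rwa [Function.iterate_succ_apply] at hk)
    -- For a cycle, `z - sd z` is the boundary of `sdHomotopy R z`; the rest is the case of `sd z`.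
    refine ⟨c + sdHomotopy R z, Submodule.add_mem _ hc (sdHomotopy_mem_chainsIn hz), ?_⟩
    have := boundary_sdHomotopy R z
    rw [hz', map_zero, add_zero] at this
    rwa [map_add, this, add_comm, ← sub_sub, sub_sub_cancel]

/-- A sum of chains in `U` and `V` that is a boundary in `U ∪ V` is a sum of boundaries. -/
theorem exists_boundary_eq_of_mem_sup {U V : Set X} (hU : IsOpen U) (hV : IsOpen V)
    {z c : SingularChain R X} (hz : z ∈ chainsIn R U ⊔ chainsIn R V)
    (hc : c ∈ chainsIn R (U ∪ V)) (h : boundary R c = z) :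
    ∃ c' ∈ chainsIn R U ⊔ chainsIn R V, boundary R c' = z := by
  obtain ⟨k, hk⟩ := exists_sd_iterate_mem_sup hU hV hc
  clear hc
  induction k generalizing c with
  | zero => exact ⟨c, hk, h⟩
  | succ k ih =>
    have hz0 : boundary R z = 0 := h ▸ boundary_boundary R c
    have hz1 : sdHomotopy R z ∈ chainsIn R U ⊔ chainsIn R V := by
      obtain ⟨a, ha, b, hb, rfl⟩ := Submodule.mem_sup.mp hz
      rw [map_add]
      exact Submodule.add_mem_sup (sdHomotopy_mem_chainsIn ha) (sdHomotopy_mem_chainsIn hb)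
    have h1 := boundary_sdHomotopy R z
    rw [hz0, map_zero, add_zero] at h1
    -- The new chain also bounds `z`, because `∂ sd c = sd z` and `∂T z = z - sd z`. The correction
    -- `T z` is already small, and `sd c` needs one subdivision fewer.
    refine ih (c := sd R c + sdHomotopy R z) ?_ ?_
    · rw [map_add, boundary_sd, h, h1, add_sub_cancel]
    · rw [← Module.End.coe_pow, map_add, Module.End.coe_pow]
      exact Submodule.add_mem _ (by rwa [Function.iterate_succ_apply] at hk)
        (sd_iterate_mem_sup hz1 k)

theorem chainsIn_inter (U V : Set X) : chainsIn R (U ∩ V) = chainsIn R U ⊓ chainsIn R V := by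
  rw [chainsIn, chainsIn, chainsIn, ← supported_inter]
  congr 1
  ext σ
  exact Set.subset_inter_iff

theorem chainsIn_mono {U V : Set X} (h : U ⊆ V) : chainsIn R U ≤ chainsIn R V :=
  supported_mono fun _ hσ => Set.Subset.trans hσ h

/-! ## Homology of subsets -/

variable (R) in
/-- The reduced homology of `U` vanishes. -/
def IsAcyclic (U : Set X) : Prop :=
  ∀ z ∈ chainsIn R U, boundary R z = 0 → ∃ c ∈ chainsIn R U, boundary R c = z

variable (R) in
/-- The reduced homology of `U` is free on the class of a cycle of simplices with `n` vertices. -/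
def IsHomologySphere (n : ℕ) (U : Set X) : Prop :=
  ∃ z ∈ chainsIn R U, z ∈ homogeneous R X n ∧ boundary R z = 0 ∧
    (∀ a : R, ∀ c ∈ chainsIn R U, boundary R c = a • z → a = 0) ∧
    ∀ z' ∈ chainsIn R U, boundary R z' = 0 →
      ∃ a : R, ∃ c ∈ chainsIn R U, boundary R c = z' - a • z

/-! ### Homotopy invariance, Mayer–Vietoris and punctured Euclidean space -/

/-- Homotopic maps send cycles to homologous cycles. -/
theorem exists_boundary_eq_sub {U : Set X} {W : Set Y} {f g : C(X, Y)} (H : f.Homotopy g)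
    (hH : ∀ x ∈ U, ∀ t, H (t, x) ∈ W) {z : SingularChain R X} (hz : z ∈ chainsIn R U)
    (hz' : boundary R z = 0) : ∃ c ∈ chainsIn R W, boundary R c = map R g z - map R f z := by
  let H' : C(X × unitInterval, Y) := H.toContinuousMap.comp .prodSwap
  refine ⟨prism R H' z, prism_mem_chainsIn hH hz, ?_⟩
  have := boundary_prism R H' f g (fun x => H.apply_zero x) (fun x => H.apply_one x) z
  rwa [hz', map_zero, add_zero] at this

theorem isHomologySphere_of_homotopyEquiv {n : ℕ} {U : Set X} {W : Set Y} {f : C(X, Y)}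
    {g : C(Y, X)} (hf : Set.MapsTo f U W) (hg : Set.MapsTo g W U)
    (H : (g.comp f).Homotopy (.id X)) (hH : ∀ x ∈ U, ∀ t, H (t, x) ∈ U)
    (H' : (f.comp g).Homotopy (.id Y)) (hH' : ∀ x ∈ W, ∀ t, H' (t, x) ∈ W)
    (h : IsHomologySphere R n U) : IsHomologySphere R n W := by
  obtain ⟨z, hzU, hzn, hz, hfree, hgen⟩ := h
  refine ⟨map R f z, map_mem_chainsIn hf hzU, map_mem_homogeneous f hzn,
    by rw [← map_boundary, hz, map_zero], fun a c hc hca => ?_, fun z' hz' hbz' => ?_⟩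
  · obtain ⟨d, hd, hdz⟩ := exists_boundary_eq_sub H hH hzU hz
    rw [map_id] at hdz
    refine hfree a (map R g c + a • d) (Submodule.add_mem _ (map_mem_chainsIn hg hc)
      (Submodule.smul_mem _ a hd)) ?_
    rw [map_add, ← map_boundary, hca, map_smul, map_smul, map_map, hdz, smul_sub,
      add_sub_cancel]
  · obtain ⟨a, c, hc, hca⟩ := hgen (map R g z') (map_mem_chainsIn hg hz')
      (by rw [← map_boundary, hbz', map_zero])
    obtain ⟨d, hd, hdz⟩ := exists_boundary_eq_sub H' hH' hz' hbz'
    rw [map_id] at hdz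
    refine ⟨a, map R f c + d, Submodule.add_mem _ (map_mem_chainsIn hf hc) hd, ?_⟩
    rw [map_add, ← map_boundary, hca, hdz, map_sub, map_map, map_smul]
    abel

/-- The suspension step of the Mayer–Vietoris sequence. -/
theorem isHomologySphere_union {n : ℕ} {U V : Set X} (hU : IsOpen U) (hV : IsOpen V)
    (hUa : IsAcyclic R U) (hVa : IsAcyclic R V) (h : IsHomologySphere R n (U ∩ V)) :
    IsHomologySphere R (n + 1) (U ∪ V) := by
  obtain ⟨z, hzUV, hzn, hz, hfree, hgen⟩ := h
  have hle : chainsIn R U ≤ chainsIn R (U ∪ V) := chainsIn_mono Set.subset_union_left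
  have hle' : chainsIn R V ≤ chainsIn R (U ∪ V) := chainsIn_mono Set.subset_union_right
  rw [chainsIn_inter] at hfree hgen hzUV
  obtain ⟨a₀, ha₀, ha₀z⟩ := hUa z hzUV.1 hz
  obtain ⟨a, ha, han, haz⟩ := exists_homogeneous_boundary hzn ha₀ ha₀z
  obtain ⟨b₀, hb₀, hb₀z⟩ := hVa z hzUV.2 hz
  obtain ⟨b, hb, hbn, hbz⟩ := exists_homogeneous_boundary hzn hb₀ hb₀z
  -- The suspension of `z`: two chains bounding `z`, one in `U` and one in `V`, glued along `z`.
  refine ⟨a - b, Submodule.sub_mem _ (hle ha) (hle' hb), Submodule.sub_mem _ han hbn,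
    by rw [map_sub, haz, hbz, sub_self], fun r c hc hcr => ?_, fun z' hz' hbz' => ?_⟩
  · obtain ⟨c', hc', hc'r⟩ := exists_boundary_eq_of_mem_sup hU hV
      (Submodule.smul_mem _ r (Submodule.sub_mem _ (Submodule.mem_sup_left ha)
        (Submodule.mem_sup_right hb))) hc hcr
    obtain ⟨d, hd, e, he, rfl⟩ := Submodule.mem_sup.mp hc'
    -- The left side is a chain in `U` and the right side in `V`, so both lie in `U ∩ V`. Their
    -- boundary is `r • z`, which forces `r = 0`.
    have key : r • a - boundary R d = r • b + boundary R e := by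
      rw [map_add, smul_sub] at hc'r
      rw [sub_eq_iff_eq_add, add_assoc, add_comm (boundary R e), hc'r]
      abel
    refine hfree r (r • a - boundary R d) ⟨?_, ?_⟩ ?_
    · exact Submodule.sub_mem _ (Submodule.smul_mem _ r ha) (boundary_mem_chainsIn hd)
    · rw [key]
      exact Submodule.add_mem _ (Submodule.smul_mem _ r hb) (boundary_mem_chainsIn he)
    · rw [map_sub, boundary_boundary, sub_zero, map_smul, haz]
  · obtain ⟨c, hc, hcz⟩ := exists_homologous_mem_sup hU hV hz' hbz'
    obtain ⟨d, hd, e, he, hde⟩ := Submodule.mem_sup.mp hcz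
    have hbd : boundary R d = - boundary R e := by
      have := congrArg (boundary R) hde
      rw [map_sub, boundary_boundary, hbz', sub_zero, map_add] at this
      exact eq_neg_of_add_eq_zero_left this
    -- The connecting map: `∂d = -∂e` is a cycle in `U ∩ V`, hence `r • z` up to `∂f`. Correcting
    -- `d` and `e` by `r • a + f` and `r • b + f` yields cycles in the acyclic sets `U` and `V`.
    obtain ⟨r, f, hf, hfr⟩ := hgen (boundary R d) ⟨boundary_mem_chainsIn hd, by
      rw [hbd]; exact Submodule.neg_mem _ (boundary_mem_chainsIn he)⟩ (boundary_boundary R d)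
    obtain ⟨g, hg, hgz⟩ := hUa (d - r • a - f) (Submodule.sub_mem _ (Submodule.sub_mem _ hd
      (Submodule.smul_mem _ r ha)) hf.1) (by
        rw [map_sub, map_sub, map_smul, haz, hfr, sub_self])
    obtain ⟨k, hk, hkz⟩ := hVa (e + r • b + f) (Submodule.add_mem _ (Submodule.add_mem _ he
      (Submodule.smul_mem _ r hb)) hf.2) (by
        rw [map_add, map_add, map_smul, hbz, hfr, hbd]; abel)
    refine ⟨r, c + g + k, Submodule.add_mem _ (Submodule.add_mem _ hc (hle hg)) (hle' hk), ?_⟩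
    rw [map_add, map_add, hgz, hkz, eq_sub_of_add_eq' hde.symm.symm, smul_sub]
    rw [← sub_eq_zero]
    have : z' = d + e + boundary R c := by rw [hde]; abel
    rw [this]
    abel

/-- Contractible subsets are acyclic. -/
theorem isAcyclic_of_homotopy {U : Set X} {a : X} (ha : a ∈ U)
    (H : (ContinuousMap.const X a).Homotopy (.id X)) (hH : ∀ x ∈ U, ∀ t, H (t, x) ∈ U) :
    IsAcyclic R U := by
  intro z hz hbz
  obtain ⟨c, hc, hcz⟩ := exists_boundary_eq_sub H hH hz hbz
  -- A simplex in a one-point space is determined by its number of vertices. Pushing forward to a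
  -- point therefore records lists over `Unit`.
  let collapse : SingularChain R X →ₗ[R] (List Unit →₀ R) :=
    lmapDomain R R fun σ => List.replicate σ.1 ()
  have collapse_push (n : ℕ) (σ : C(stdSimplex ℝ (Fin n), X))
      (d : List (stdSimplex ℝ (Fin n)) →₀ R) :
      collapse (push R σ d) = ListChain.map R (fun _ => ()) d := by
    have : collapse ∘ₗ push R σ = ListChain.map R (fun _ => ()) := by
      ext l : 2
      simp only [LinearMap.comp_apply, lsingle_apply, push_single, ListChain.map_single, collapse,
        lmapDomain_apply, mapDomain_single, simplex]
      congr 1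
      conv_rhs => rw [← ofFn_equivSigmaTuple l, List.map_ofFn]
      simp
    exact LinearMap.congr_fun this d
  have collapse_boundary (d : SingularChain R X) :
      collapse (boundary R d) = ListChain.boundary R (collapse d) := by
    have : collapse ∘ₗ boundary R = ListChain.boundary R ∘ₗ collapse :=
      hom_ext R fun n σ => by
        simp only [LinearMap.comp_apply, boundary_push, collapse_push, ListChain.map_boundary]
    exact LinearMap.congr_fun this d
  let p : C(Unit, X) := ContinuousMap.const _ a
  have hconst : map R (ContinuousMap.const X a) z = push R p (collapse z) := by
    have : map R (ContinuousMap.const X a) = push R p ∘ₗ collapse :=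
      hom_ext R fun n σ => by
        rw [LinearMap.comp_apply, collapse_push, map_push]
        exact (push_map R p isAffine_const _).symm
    exact LinearMap.congr_fun this z
  -- The collapsed cycle bounds its own cone from the point, and `c` accounts for the homotopy to
  -- the constant map.
  refine ⟨c + push R p (ListChain.cone R () (collapse z)), Submodule.add_mem _ hc
    (push_mem_chainsIn (by rintro _ ⟨x, rfl⟩; exact ha) _), ?_⟩
  rw [map_add, hcz, boundary_push, ListChain.boundary_cone, ← collapse_boundary, hbz, map_zero,
    map_zero, sub_zero, ← hconst, map_id, sub_add_cancel]

theorem isAcyclic_of_starConvex {E : Type*} [AddCommGroup E] [Module ℝ E] [TopologicalSpace E]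
    [IsTopologicalAddGroup E] [ContinuousSMul ℝ E] {U : Set E} {a : E} (ha : a ∈ U)
    (h : StarConvex ℝ a U) : IsAcyclic R U := by
  let H : (ContinuousMap.const E a).Homotopy (.id E) :=
    { toFun := fun p => AffineMap.lineMap a p.2 (p.1 : ℝ)
      continuous_toFun := by
        simp only [AffineMap.lineMap_apply_module]
        fun_prop
      map_zero_left := by simp
      map_one_left := by simp }
  refine isAcyclic_of_homotopy ha H fun x hx t => ?_
  change AffineMap.lineMap a x (t : ℝ) ∈ U
  rw [AffineMap.lineMap_apply_module]
  exact h hx (sub_nonneg.mpr t.2.2) t.2.1 (by ring)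

/-- The empty set is a sphere of dimension `-1`. -/
theorem isHomologySphere_empty : IsHomologySphere R 0 (∅ : Set X) := by
  have hempty (σ : SingularSimplex X) (hσ : Set.range σ.2 ⊆ ∅) : σ.1 = 0 := by
    obtain ⟨n, σ⟩ := σ
    by_contra hn
    obtain ⟨k, rfl⟩ := Nat.exists_eq_succ_of_ne_zero hn
    exact hσ ⟨stdSimplex.vertex 0, rfl⟩
  have : IsEmpty (stdSimplex ℝ (Fin 0)) := ⟨fun t => by simpa using t.2.2⟩
  let e : SingularSimplex X := ⟨0, ⟨fun t => isEmptyElim t, continuous_of_const fun t => isEmptyElim t⟩⟩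
  have he (σ : SingularSimplex X) (hσ : Set.range σ.2 ⊆ ∅) : σ = e := by
    obtain ⟨n, σ⟩ := σ
    obtain rfl : n = 0 := hempty _ hσ
    congr 1
    ext t
    exact isEmptyElim t
  have hb {c : SingularChain R X} (hc : c ∈ chainsIn R (∅ : Set X)) : boundary R c = 0 :=
    boundary_eq_zero (supported_mono (fun σ hσ => hempty σ hσ) hc)
  have hmem : single e 1 ∈ chainsIn R (∅ : Set X) :=
    single_mem_supported R 1 (by rintro _ ⟨t, -⟩; exact isEmptyElim t)
  refine ⟨single e 1, hmem, single_mem_supported R 1 rfl, hb hmem, fun a c hc h => ?_,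
    fun z hz _ => ⟨z e, 0, Submodule.zero_mem _, ?_⟩⟩
  · rw [hb hc] at h
    simpa using congr($h e).symm
  · rw [map_zero, eq_comm, sub_eq_zero]
    ext σ
    by_cases hσ : σ = e
    · simp [hσ]
    · rw [(mem_supported' R _).mp hz σ fun h => hσ (he σ h)]
      simp [Ne.symm hσ]

/-- Induction by suspension: `ℝ^(k+1) \ {0}` is the union of the complements of two opposite closed
half-axes. These are star-shaped, and their intersection retracts onto `ℝ^k \ {0}`. The base case is
the empty set, the sphere of dimension `-1`. -/
theorem isHomologySphere_ne_zero (k : ℕ) :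
    IsHomologySphere R k {x : Fin k → ℝ | x ≠ 0} := by
  induction k with
  | zero =>
    convert isHomologySphere_empty (R := R) (X := Fin 0 → ℝ)
    ext x
    simpa using Subsingleton.elim x 0
  | succ k ih =>
    let U : Set (Fin (k + 1) → ℝ) := {x | 0 < x 0} ∪ {x | Fin.tail x ≠ 0}
    let V : Set (Fin (k + 1) → ℝ) := {x | x 0 < 0} ∪ {x | Fin.tail x ≠ 0}
    have htail : Continuous (Fin.tail : (Fin (k + 1) → ℝ) → (Fin k → ℝ)) :=
      continuous_pi fun i => continuous_apply i.succ
    have hT : IsOpen {x : Fin (k + 1) → ℝ | Fin.tail x ≠ 0} :=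
      isOpen_ne_fun htail continuous_const
    have hU : IsOpen U := (isOpen_lt continuous_const (continuous_apply 0)).union hT
    have hV : IsOpen V := (isOpen_lt (continuous_apply 0) continuous_const).union hT
    have hUV : {x : Fin (k + 1) → ℝ | x ≠ 0} = U ∪ V := by
      ext x
      have : x = 0 ↔ x 0 = 0 ∧ Fin.tail x = 0 := by
        constructor
        · rintro rfl
          exact ⟨rfl, rfl⟩
        · rintro ⟨h0, h1⟩
          ext i
          refine Fin.cases h0 (fun j => congrFun h1 j) i
      simp only [Set.mem_ofPred_eq, ne_eq, this, U, V, Set.mem_union]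
      rcases lt_trichotomy (x 0) 0 with h | h | h
      · simp [h, h.ne, h.not_gt]
      · simp [h]
      · simp [h, h.ne', h.not_gt]
    have hinter : U ∩ V = {x | Fin.tail x ≠ 0} := by
      ext x
      simp only [U, V, Set.mem_inter_iff, Set.mem_union, Set.mem_ofPred_eq]
      constructor
      · rintro ⟨h | h, h' | h'⟩
        · exact (h.not_gt h').elim
        all_goals assumption
      · exact fun h => ⟨.inr h, .inr h⟩
    -- One statement for both half-axes: the sign `s = 1` gives `U` and `s = -1` gives `V`, with
    -- star centre `(s, 0)`.
    have hstar {s : ℝ} (hs : s ≠ 0) :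
        StarConvex ℝ (Fin.cons s 0 : Fin (k + 1) → ℝ) ({x | 0 < s * x 0} ∪ {x | Fin.tail x ≠ 0}) := by
      intro x hx a b ha hb hab
      by_cases htx : Fin.tail x = 0
      · have hx0 : 0 < s * x 0 := hx.resolve_right fun h => h htx
        left
        simp only [Set.mem_ofPred_eq, Pi.add_apply, Pi.smul_apply, Fin.cons_zero, smul_eq_mul]
        have : s * (a * s + b * x 0) = a * s ^ 2 + b * (s * x 0) := by ring
        rw [this]
        have hs2 : 0 < s ^ 2 := by positivity
        rcases ha.eq_or_lt with rfl | ha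
        · have : b = 1 := by linarith
          subst this
          linarith
        · positivity
      · rcases hb.eq_or_lt with rfl | hb
        · left
          have : a = 1 := by linarith
          subst this
          simp only [one_smul, zero_smul, add_zero, Set.mem_ofPred_eq, Fin.cons_zero]
          exact mul_self_pos.mpr hs
        · right
          simp only [Set.mem_ofPred_eq]
          intro h
          refine htx ?_
          ext i
          have h' : a * 0 + b * Fin.tail x i = 0 := congrFun h i
          rw [mul_zero, zero_add] at h'
          exact (mul_eq_zero.mp h').resolve_left hb.ne'
    have hUa : IsAcyclic R U := by
      refine isAcyclic_of_starConvex (a := Fin.cons 1 0) (.inl (by simp)) ?_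
      simpa [U] using hstar one_ne_zero
    have hVa : IsAcyclic R V := by
      refine isAcyclic_of_starConvex (a := Fin.cons (-1) 0) (.inl (by simp)) ?_
      simpa [V] using hstar (neg_ne_zero.mpr (one_ne_zero (α := ℝ)))
    rw [hUV]
    refine isHomologySphere_union hU hV hUa hVa ?_
    rw [hinter]
    let f : C(Fin k → ℝ, Fin (k + 1) → ℝ) := ⟨fun x => Fin.cons 0 x, by fun_prop⟩
    let g : C(Fin (k + 1) → ℝ, Fin k → ℝ) := ⟨Fin.tail, htail⟩
    let H : (f.comp g).Homotopy (.id _) :=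
      { toFun := fun p => Fin.cons ((p.1 : ℝ) * p.2 0) (Fin.tail p.2)
        continuous_toFun := by
          refine Continuous.finCons ?_ (htail.comp continuous_snd)
          fun_prop
        map_zero_left := by simp [f, g]
        map_one_left := by simp }
    let H₀ : (g.comp f).Homotopy (.id _) :=
      { toFun := fun p => p.2
        continuous_toFun := continuous_snd
        map_zero_left := by simp [f, g]
        map_one_left := by simp }
    refine isHomologySphere_of_homotopyEquiv (f := f) (g := g) (U := {x | x ≠ 0})
      (fun x hx => ?_) (fun x hx => hx) H₀ (fun x hx t => hx) H (fun x hx t => hx) ih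
    simpa [f] using hx

end SingularChain

/-! ## Comparison with the singular chain complex of the library -/

namespace ListChain

open Finsupp

theorem boundary_single_ofFn {R : Type*} [CommRing R] {K : Type*} {n : ℕ} (v : Fin (n + 1) → K) :
    boundary R (single (List.ofFn v) 1)
      = ∑ i : Fin (n + 1), (-1 : ℤ) ^ (i : ℕ) • single (List.ofFn (v ∘ i.succAbove)) (1 : R) := by
  induction n with
  | zero => simp [List.ofFn_succ, boundary_single_cons]
  | succ n ih =>
    rw [List.ofFn_succ, boundary_single_cons, ih (fun i => v i.succ), map_sum, sub_eq_add_neg,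
      ← Finset.sum_neg_distrib]
    conv_rhs => rw [Fin.sum_univ_succ]
    congr 1
    · simp [Function.comp_def]
    · refine Finset.sum_congr rfl fun i _ => ?_
      rw [map_zsmul, cone_single, Fin.val_succ, pow_succ, mul_neg_one, neg_smul]
      congr 3
      rw [List.ofFn_succ]
      simp [Function.comp_def, Fin.succ_succAbove_succ]

end ListChain

namespace SingularChain

open CategoryTheory AlgebraicTopology Finsupp Simplicial ConvexCombSpace

variable (F : Type v) [Field F] (X : Type) [TopologicalSpace X]

/-- The singular chain complex. -/
noncomputable abbrev complex : ChainComplex (ModuleCat.{v} F) ℕ :=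
  ((singularChainComplexFunctor (ModuleCat.{v} F)).obj (ModuleCat.of F F)).obj (TopCat.of X)

variable {X}

/-- The inclusion of the summand of a simplex into the singular chain complex. -/
noncomputable def complexι {n : ℕ} (σ : C(stdSimplex ℝ (Fin (n + 1)), X)) :
    ModuleCat.of F F ⟶ (complex F X).X n :=
  Limits.Sigma.ι (fun _ : (TopCat.toSSet.obj (TopCat.of X)).obj (.op ⦋n⦌) => ModuleCat.of F F)
    (((TopCat.of X).toSSetObjEquiv (.op ⦋n⦌)).symm σ)

/-- The map out of the singular chain complex with the given values on simplices. -/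
noncomputable def complexDesc {n : ℕ} {M : ModuleCat.{v} F}
    (f : C(stdSimplex ℝ (Fin (n + 1)), X) → (ModuleCat.of F F ⟶ M)) : (complex F X).X n ⟶ M :=
  Limits.Sigma.desc fun s => f ((TopCat.of X).toSSetObjEquiv (.op ⦋n⦌) s)

variable {F}

@[simp]
theorem complexι_complexDesc {n : ℕ} {M : ModuleCat.{v} F}
    (f : C(stdSimplex ℝ (Fin (n + 1)), X) → (ModuleCat.of F F ⟶ M))
    (σ : C(stdSimplex ℝ (Fin (n + 1)), X)) : complexι F σ ≫ complexDesc F f = f σ :=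
  (Limits.Sigma.ι_desc _ _).trans (by rw [Equiv.apply_symm_apply])

theorem complex_hom_ext {n : ℕ} {M : ModuleCat.{v} F} {f g : (complex F X).X n ⟶ M}
    (h : ∀ σ : C(stdSimplex ℝ (Fin (n + 1)), X), complexι F σ ≫ f = complexι F σ ≫ g) : f = g :=
  Limits.Sigma.hom_ext _ _ fun s => by
    obtain ⟨σ, rfl⟩ := ((TopCat.of X).toSSetObjEquiv (.op ⦋n⦌)).symm.surjective s
    exact h σ

/-- The face of a singular simplex. -/
noncomputable def face {n : ℕ} (σ : C(stdSimplex ℝ (Fin (n + 2)), X)) (i : Fin (n + 2)) :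
    C(stdSimplex ℝ (Fin (n + 1)), X) :=
  σ.comp (comb (stdSimplex.vertex ∘ i.succAbove))

theorem comb_vertex_comp {m n : ℕ} (f : Fin m → Fin n) (t : stdSimplex ℝ (Fin m)) :
    comb (stdSimplex.vertex ∘ f) t = stdSimplex.map f t := by
  ext i
  rw [stdSimplex_comb_apply, stdSimplex.map_coe, FunOnFinite.linearMap_apply_apply,
    Finset.sum_filter]
  refine Finset.sum_congr rfl fun j _ => ?_
  simp [Pi.single_apply, eq_comm]

theorem complexι_d {n : ℕ} (σ : C(stdSimplex ℝ (Fin (n + 2)), X)) :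
    complexι F σ ≫ (complex F X).d (n + 1) n
      = ∑ i : Fin (n + 2), (-1 : ℤ) ^ (i : ℕ) • complexι F (face σ i) := by
  let S : SimplicialObject (ModuleCat.{v} F) :=
    ((SimplicialObject.whiskering _ _).obj (Limits.sigmaConst.obj (ModuleCat.of F F))).obj
      (TopCat.toSSet.obj (TopCat.of X))
  have hd : (complex F X).d (n + 1) n = AlternatingFaceMapComplex.objD S n :=
    alternatingFaceMapComplex_obj_d S n
  let ι (k : ℕ) (τ : C(stdSimplex ℝ (Fin (k + 1)), X)) : ModuleCat.of F F ⟶ S _⦋k⦌ :=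
    complexι F τ
  have key : ι (n + 1) σ ≫ AlternatingFaceMapComplex.objD S n
      = ∑ i : Fin (n + 2), (-1 : ℤ) ^ (i : ℕ) • ι n (face σ i) := by
    rw [AlternatingFaceMapComplex.objD, Preadditive.comp_sum]
    refine Finset.sum_congr rfl fun i _ => ?_
    rw [Preadditive.comp_zsmul]
    congr 1
    refine (Limits.Sigma.ι_comp_map' _ _ _).trans ?_
    rw [Category.id_comp]
    refine congrArg (Limits.Sigma.ι (fun _ : (TopCat.toSSet.obj (TopCat.of X)).obj (.op ⦋n⦌) =>
      ModuleCat.of F F)) ?_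
    rw [Equiv.eq_symm_apply]
    ext t
    exact congrArg σ (comb_vertex_comp _ t).symm
  exact (congrArg (complexι F σ ≫ ·) hd).trans key

variable {V : Type} [TopologicalSpace V]

variable (F) in
/-- The comparison map to the singular chains of an ambient space. -/
noncomputable def toChain (U : Set V) (n : ℕ) :
    (complex F U).X n ⟶ ModuleCat.of F (SingularChain F V) :=
  -- Degree `n` corresponds to `n + 1` vertices, since the augmented complex counts vertices.
  complexDesc F fun σ => ModuleCat.ofHom
    (lsingle ⟨n + 1, (ContinuousMap.mk (Subtype.val : U → V)).comp σ⟩)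

theorem complexι_toChain {U : Set V} {n : ℕ} (σ : C(stdSimplex ℝ (Fin (n + 1)), U)) (r : F) :
    toChain F U n (complexι F σ r)
      = single ⟨n + 1, (ContinuousMap.mk (Subtype.val : U → V)).comp σ⟩ r := by
  have h : complexι F σ ≫ toChain F U n = ModuleCat.ofHom
      (lsingle ⟨n + 1, (ContinuousMap.mk (Subtype.val : U → V)).comp σ⟩) :=
    complexι_complexDesc _ σ
  exact congr(($h).hom r)

theorem toChain_d (U : Set V) (n : ℕ) (x : (complex F U).X (n + 1)) :
    toChain F U n ((complex F U).d (n + 1) n x) = boundary F (toChain F U (n + 1) x) := by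
  have : (complex F U).d (n + 1) n ≫ toChain F U n
      = toChain F U (n + 1) ≫ ModuleCat.ofHom (boundary F) := by
    refine complex_hom_ext fun σ => ?_
    rw [← Category.assoc, complexι_d, Preadditive.sum_comp, ← Category.assoc, toChain, toChain,
      complexι_complexDesc]
    simp only [Preadditive.zsmul_comp, complexι_complexDesc]
    refine ModuleCat.hom_ext (LinearMap.ext_ring ?_)
    rw [ModuleCat.hom_sum]
    simp only [LinearMap.sum_apply, ModuleCat.hom_zsmul, ModuleCat.hom_comp, ModuleCat.hom_ofHom,
      LinearMap.comp_apply, LinearMap.smul_apply, lsingle_apply]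
    rw [← push_vertices, boundary_push, vertices, ListChain.boundary_single_ofFn, map_sum]
    refine Finset.sum_congr rfl fun i _ => ?_
    rw [map_zsmul, push_single, simplex, equivSigmaTuple_ofFn]
    rfl
  exact congr(($this).hom x)

/-- The finitely supported functions on simplices map onto the categorical coproduct. Composed with
the comparison, this map is the pushforward along an injection of simplices, hence injective. -/
theorem toChain_injective (U : Set V) (n : ℕ) : Function.Injective (toChain F U n) := by
  let φ : (C(stdSimplex ℝ (Fin (n + 1)), U) →₀ F) →ₗ[F] (complex F U).X n :=
    linearCombination F fun σ => complexι F σ (1 : F)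
  let β : (complex F U).X n ⟶ ModuleCat.of F (C(stdSimplex ℝ (Fin (n + 1)), U) →₀ F) :=
    complexDesc F fun σ => ModuleCat.ofHom (lsingle σ)
  have hβ : β ≫ ModuleCat.ofHom φ = 𝟙 _ := by
    refine complex_hom_ext fun σ => ?_
    rw [← Category.assoc, complexι_complexDesc, Category.comp_id]
    refine ModuleCat.hom_ext (LinearMap.ext_ring ?_)
    simp [φ]
  have hφ : Function.Surjective φ := fun x => ⟨β x, congr(($hβ).hom x)⟩
  have hcomp (y) : toChain F U n (φ y) = mapDomain
      (fun σ => ⟨n + 1, (ContinuousMap.mk (Subtype.val : U → V)).comp σ⟩) y := by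
    have : (toChain F U n).hom ∘ₗ φ = lmapDomain F F
        (fun σ => ⟨n + 1, (ContinuousMap.mk (Subtype.val : U → V)).comp σ⟩) := by
      ext σ : 2
      simp only [LinearMap.comp_apply, lsingle_apply, φ, linearCombination_single, one_smul,
        lmapDomain_apply, mapDomain_single]
      exact complexι_toChain σ 1
    exact LinearMap.congr_fun this y
  have hinj : Function.Injective fun σ : C(stdSimplex ℝ (Fin (n + 1)), U) =>
      (⟨n + 1, (ContinuousMap.mk (Subtype.val : U → V)).comp σ⟩ : SingularSimplex V) := by
    intro σ τ h
    have := eq_of_heq (Sigma.mk.inj h).2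
    ext t
    exact congr($this t)
  intro x y hxy
  obtain ⟨x, rfl⟩ := hφ x
  obtain ⟨y, rfl⟩ := hφ y
  rw [hcomp, hcomp] at hxy
  rw [mapDomain_injective hinj hxy]

theorem toChain_mem (U : Set V) (n : ℕ) (x : (complex F U).X n) :
    toChain F U n x ∈ chainsIn F U ⊓ homogeneous F V (n + 1) := by
  let p : Submodule F (SingularChain F V) := chainsIn F U ⊓ homogeneous F V (n + 1)
  have : toChain F U n ≫ ModuleCat.ofHom p.mkQ = 0 := by
    refine complex_hom_ext fun σ => ?_
    rw [Limits.comp_zero]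
    refine ModuleCat.hom_ext (LinearMap.ext_ring ?_)
    have h : p.mkQ (toChain F U n (complexι F σ (1 : F))) = 0 := by
      rw [complexι_toChain, Submodule.mkQ_apply, Submodule.Quotient.mk_eq_zero]
      refine ⟨single_mem_supported F 1 ?_, single_mem_supported F 1 rfl⟩
      rintro _ ⟨t, rfl⟩
      exact (σ t).2
    exact h
  have h : p.mkQ (toChain F U n x) = 0 := congr(($this).hom x)
  rwa [Submodule.mkQ_apply, Submodule.Quotient.mk_eq_zero] at h

theorem exists_toChain_eq {U : Set V} {n : ℕ} {c : SingularChain F V} (hc : c ∈ chainsIn F U)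
    (hn : c ∈ homogeneous F V (n + 1)) : ∃ x, toChain F U n x = c := by
  have hc' : c ∈ supported F F ({σ | Set.range σ.2 ⊆ U} ∩ {σ | σ.1 = n + 1}) := by
    rw [supported_inter]
    exact ⟨hc, hn⟩
  refine map_mem_of_single (LinearMap.id) (p := (toChain F U n).hom.range) ?_ hc'
  rintro ⟨_, σ⟩ ⟨hσ, rfl : _ = n + 1⟩
  exact ⟨complexι F ⟨fun t => ⟨σ t, hσ ⟨t, rfl⟩⟩, by fun_prop⟩ 1, complexι_toChain _ _⟩

end SingularChain

section

open CategoryTheory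

/-- The homology in the middle degree is one-dimensional if it is so on the level of elements. -/
theorem ChainComplex.exists_homology_generator {F : Type v} [Field F]
    (K : ChainComplex (ModuleCat.{v} F) ℕ) (n : ℕ) {x : K.X (n + 1)} (hx : K.d (n + 1) n x = 0)
    (hfree : ∀ (a : F) y, K.d (n + 2) (n + 1) y = a • x → a = 0)
    (hgen : ∀ x', K.d (n + 1) n x' = 0 → ∃ (a : F) (y : _), K.d (n + 2) (n + 1) y = x' - a • x) :
    ∃ c : K.homology (n + 1), Submodule.span F {c} = ⊤ ∧ c ≠ 0 := by
  let S := K.sc' (n + 2) (n + 1) n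
  let e : K.homology (n + 1) ≃ₗ[F] LinearMap.ker S.g.hom ⧸ LinearMap.range S.moduleCatToCycles :=
    (K.homologyIsoSc' (n + 2) (n + 1) n (by simp) (by simp) ≪≫
      S.moduleCatHomologyIso).toLinearEquiv
  let c : LinearMap.ker S.g.hom ⧸ LinearMap.range S.moduleCatToCycles :=
    Submodule.Quotient.mk ⟨x, hx⟩
  have hc0 : c ≠ 0 := by
    intro h
    obtain ⟨y, hy⟩ := (Submodule.Quotient.mk_eq_zero _).mp h
    have := hfree 1 y (by rw [one_smul]; exact congrArg Subtype.val hy)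
    exact one_ne_zero this
  have hspan (d : LinearMap.ker S.g.hom ⧸ LinearMap.range S.moduleCatToCycles) :
      ∃ a : F, a • c = d := by
    obtain ⟨⟨x', hx'⟩, rfl⟩ := Submodule.Quotient.mk_surjective _ d
    obtain ⟨a, y, hy⟩ := hgen x' hx'
    refine ⟨a, ?_⟩
    rw [← Submodule.Quotient.mk_smul, eq_comm, Submodule.Quotient.eq]
    exact ⟨y, Subtype.ext hy⟩
  refine ⟨e.symm c, ?_, fun h => hc0 ?_⟩
  · rw [Submodule.eq_top_iff']
    intro d
    obtain ⟨a, ha⟩ := hspan (e d)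
    rw [Submodule.mem_span_singleton]
    exact ⟨a, by rw [← map_smul, ha, LinearEquiv.symm_apply_apply]⟩
  · exact e.symm.map_eq_zero_iff.mp h

end

/-- A cycle with `n + 2` vertices has degree `n + 1 ≥ 1`. There the augmentation plays no role and
reduced homology is ordinary homology. -/
theorem SingularChain.IsHomologySphere.exists_generator {F : Type v} [Field F] {V : Type}
    [TopologicalSpace V] {U : Set V} {n : ℕ} (h : IsHomologySphere F (n + 2) U) :
    ∃ c : NodalTopology.Homology F (n + 1) U, Submodule.span F {c} = ⊤ ∧ c ≠ 0 := by
  obtain ⟨z, hzU, hzn, hz, hfree, hgen⟩ := h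
  obtain ⟨x, rfl⟩ := exists_toChain_eq hzU hzn
  refine ChainComplex.exists_homology_generator (complex F U) n (x := x) ?_ ?_ ?_
  · exact toChain_injective U n (by rw [toChain_d, hz, map_zero])
  · intro a y hy
    refine hfree a _ (toChain_mem U (n + 2) y).1 ?_
    rw [← toChain_d, hy, map_smul]
  · intro x' hx'
    obtain ⟨a, c, hc, hca⟩ := hgen _ (toChain_mem U (n + 1) x').1
      (by rw [← toChain_d, hx', map_zero])
    obtain ⟨c', hc', hcn, hca'⟩ := exists_homogeneous_boundary (Submodule.sub_mem _
      (toChain_mem U (n + 1) x').2 (Submodule.smul_mem _ a hzn)) hc hca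
    obtain ⟨y, rfl⟩ := exists_toChain_eq hc' hcn
    refine ⟨a, y, toChain_injective U (n + 1) ?_⟩
    rw [toChain_d, hca', map_sub, map_smul]

/-! ## Homology of spheres and of punctured spaces -/

namespace NodalTopology

open CategoryTheory

section Functoriality

variable (F : Type v) [Field F] (k : ℕ) {X Y Z : Type} [TopologicalSpace X] [TopologicalSpace Y]
  [TopologicalSpace Z]

theorem homologyMap_id (x : Homology F k X) : homologyMap F k (.id X) x = x :=
  congr(($(((AlgebraicTopology.singularHomologyFunctor (ModuleCat.{v} F) k).obj
    (ModuleCat.of F F)).map_id (TopCat.of X))).hom x)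

theorem homologyMap_comp (g : C(Y, Z)) (f : C(X, Y)) (x : Homology F k X) :
    homologyMap F k (g.comp f) x = homologyMap F k g (homologyMap F k f x) :=
  congr(($(((AlgebraicTopology.singularHomologyFunctor (ModuleCat.{v} F) k).obj
    (ModuleCat.of F F)).map_comp (TopCat.ofHom f) (TopCat.ofHom g))).hom x)

variable {f g : C(X, Y)}

theorem homologyMap_eq_of_homotopic (h : f.Homotopic g) : homologyMap F k f = homologyMap F k g := by
  obtain ⟨H⟩ := h
  let H' : TopCat.Homotopy (TopCat.ofHom f) (TopCat.ofHom g) := H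
  exact congrArg ModuleCat.Hom.hom
    (H'.congr_homologyMap_singularChainComplexFunctor (ModuleCat.of F F) k)

variable {k}

/-- The constant map factors through a point, whose homology vanishes in positive degree. -/
theorem homologyMap_const (hk : k ≠ 0) (y : Y) (x : Homology F k X) :
    homologyMap F k (.const X y) x = 0 := by
  have hz := AlgebraicTopology.isZero_singularHomologyFunctor_of_totallyDisconnectedSpace
    (ModuleCat.{v} F) k (ModuleCat.of F F) (TopCat.of Unit) hk
  have : Subsingleton (Homology F k Unit) := ModuleCat.subsingleton_of_isZero hz
  have : (ContinuousMap.const X y) = (ContinuousMap.const Unit y).comp (.const X ()) := rfl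
  rw [this, homologyMap_comp, Subsingleton.elim (homologyMap F k _ x) 0, map_zero]

theorem homologyMap_eq_zero_of_nullhomotopic (hk : k ≠ 0) (h : f.Nullhomotopic)
    (x : Homology F k X) : homologyMap F k f x = 0 := by
  obtain ⟨y, h⟩ := h
  rw [homologyMap_eq_of_homotopic F k h, homologyMap_const F hk]

theorem homologyMap_injective_of_leftInverse {f : C(X, Y)} {r : C(Y, X)}
    (h : (r.comp f).Homotopic (.id X)) : Function.Injective (homologyMap F k f) := by
  refine Function.LeftInverse.injective (g := homologyMap F k r) fun x => ?_
  rw [← homologyMap_comp, homologyMap_eq_of_homotopic F k h, homologyMap_id]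

end Functoriality

/-! ### Generators for spheres and independence in punctured spaces -/

/-- Two maps into a subset are homotopic if the segments between their values lie in it. -/
theorem homotopic_of_segment {X V : Type} [TopologicalSpace X] [AddCommGroup V] [Module ℝ V]
    [TopologicalSpace V] [IsTopologicalAddGroup V] [ContinuousSMul ℝ V] {p : V → Prop}
    (f g : C(X, {x : V // p x})) (h : ∀ x, ∀ y ∈ segment ℝ (f x : V) (g x), p y) :
    f.Homotopic g :=
  ⟨{ toFun := fun q => ⟨AffineMap.lineMap (f q.2 : V) (g q.2 : V) (q.1 : ℝ), h q.2 _ (by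
        rw [segment_eq_image_lineMap]
        exact ⟨q.1, q.1.2, rfl⟩)⟩
     continuous_toFun := by
      refine Continuous.subtype_mk ?_ _
      simp only [AffineMap.lineMap_apply_module]
      fun_prop
     map_zero_left := fun x => Subtype.ext (by simp)
     map_one_left := fun x => Subtype.ext (by simp) }⟩

/-- Radial normalisation makes the sphere a deformation retract of punctured Euclidean space, so the
generator found there is transported. -/
theorem exists_generator_homology_sphere (F : Type v) [Field F] {l : ℕ} (hl : 1 ≤ l) :
    ∃ c : Homology F l (Metric.sphere (0 : E (l + 1)) 1), Submodule.span F {c} = ⊤ ∧ c ≠ 0 := by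
  obtain ⟨n, rfl⟩ := Nat.exists_eq_add_of_le' hl
  obtain ⟨c, hc, hc0⟩ :=
    (SingularChain.isHomologySphere_ne_zero (R := F) (n + 2)).exists_generator
  let A : Set (Fin (n + 2) → ℝ) := {x | x ≠ 0}
  have hne (x : A) : ‖(WithLp.toLp 2 x.1 : E (n + 2))‖ ≠ 0 :=
    norm_ne_zero_iff.mpr fun h => x.2 (by simpa using h)
  have hcont : Continuous fun x : A => (WithLp.toLp 2 x.1 : E (n + 2)) :=
    (PiLp.continuous_toLp 2 _).comp continuous_subtype_val
  let r : C(A, Metric.sphere (0 : E (n + 2)) 1) :=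
    ⟨fun x => ⟨‖(WithLp.toLp 2 x.1 : E (n + 2))‖⁻¹ • WithLp.toLp 2 x.1, by
      rw [mem_sphere_zero_iff_norm, norm_smul, norm_inv, norm_norm, inv_mul_cancel₀ (hne x)]⟩,
      by
        refine Continuous.subtype_mk ?_ _
        exact (hcont.norm.inv₀ hne).smul hcont⟩
  let i : C(Metric.sphere (0 : E (n + 2)) 1, A) :=
    ⟨fun s => ⟨WithLp.ofLp s.1, by
      have : (s : E (n + 2)) ≠ 0 := by
        intro h
        simpa [h] using s.2
      simpa [A] using this⟩, by fun_prop⟩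
  have hri : r.comp i = .id _ := by
    ext s : 2
    simp [r, i, norm_eq_of_mem_sphere]
  have hir : (i.comp r).Homotopic (.id A) := by
    refine homotopic_of_segment _ _ fun x y hy => ?_
    obtain ⟨a, b, ha, hb, hab, rfl⟩ := hy
    have hx' : 0 < ‖(WithLp.toLp 2 x.1 : E (n + 2))‖⁻¹ :=
      inv_pos.mpr (lt_of_le_of_ne (norm_nonneg _) (hne x).symm)
    have e : a • ((i.comp r) x : Fin (n + 2) → ℝ) + b • ((ContinuousMap.id A) x : Fin (n + 2) → ℝ)
        = (a * ‖(WithLp.toLp 2 x.1 : E (n + 2))‖⁻¹ + b) •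
          (x : Fin (n + 2) → ℝ) := by
      rw [add_smul, mul_smul]
      rfl
    rw [e]
    refine smul_ne_zero (ne_of_gt ?_) x.2
    rcases ha.eq_or_lt with rfl | ha
    · rw [zero_mul, zero_add]; linarith
    · positivity
  have hsurj (x) : homologyMap F (n + 1) r (homologyMap F (n + 1) i x) = x := by
    rw [← homologyMap_comp, hri, homologyMap_id]
  refine ⟨homologyMap F (n + 1) r c, ?_, fun h => hc0 ?_⟩
  · have := congrArg (Submodule.map (homologyMap F (n + 1) r)) hc
    rwa [Submodule.map_span, Set.image_singleton, Submodule.map_top,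
      LinearMap.range_eq_top.mpr fun x => ⟨_, hsurj x⟩] at this
  · exact homologyMap_injective_of_leftInverse F (r := i) hir (h.trans (map_zero _).symm)

/-- The inclusion of the unit sphere into the complement of a point of the open unit ball is
injective on homology. -/
theorem homologyMap_sphere_injective (F : Type v) [Field F] (k : ℕ) {V : Type}
    [NormedAddCommGroup V] [NormedSpace ℝ V] {q : V} (hq : ‖q‖ < 1)
    (f : C(Metric.sphere (0 : V) 1, {x : V // x ≠ q})) (hf : ∀ s, (f s : V) = s) :
    Function.Injective (homologyMap F k f) := by
  have hne (x : {x : V // x ≠ q}) : ‖x.1 - q‖ ≠ 0 := norm_ne_zero_iff.mpr (sub_ne_zero.mpr x.2)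
  have hcont' : Continuous fun x : {x : V // x ≠ q} => x.1 - q := by fun_prop
  let r : C({x : V // x ≠ q}, Metric.sphere (0 : V) 1) :=
    ⟨fun x => ⟨‖x.1 - q‖⁻¹ • (x.1 - q), by
      rw [mem_sphere_zero_iff_norm, norm_smul, norm_inv, norm_norm, inv_mul_cancel₀ (hne x)]⟩,
      by
        refine Continuous.subtype_mk ?_ _
        exact (hcont'.norm.inv₀ hne).smul hcont'⟩
  refine homologyMap_injective_of_leftInverse F (r := r) ⟨ContinuousMap.Homotopy.symm ?_⟩
  -- Moving the centre from `0` to `q` never meets the sphere because `‖t q‖ < 1`. This deforms the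
  -- identity into the radial projection from `q`.
  have hpos (p : unitInterval × Metric.sphere (0 : V) 1) : ‖(p.2 : V) - (p.1 : ℝ) • q‖ ≠ 0 := by
    refine ne_of_gt (lt_of_lt_of_le ?_ (norm_sub_norm_le _ _))
    rw [norm_eq_of_mem_sphere p.2, norm_smul, Real.norm_of_nonneg p.1.2.1]
    nlinarith [p.1.2.2, p.1.2.1, norm_nonneg q]
  have hcont : Continuous fun p : unitInterval × Metric.sphere (0 : V) 1 =>
      (p.2 : V) - (p.1 : ℝ) • q := by fun_prop
  exact
    { toFun := fun p => ⟨‖(p.2 : V) - (p.1 : ℝ) • q‖⁻¹ • ((p.2 : V) - (p.1 : ℝ) • q), by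
        rw [mem_sphere_zero_iff_norm, norm_smul, norm_inv, norm_norm, inv_mul_cancel₀ (hpos p)]⟩
      continuous_toFun := by
        refine Continuous.subtype_mk ?_ _
        exact (hcont.norm.inv₀ hpos).smul hcont
      map_zero_left := fun s => Subtype.ext (by simp [norm_eq_of_mem_sphere])
      map_one_left := fun s => Subtype.ext (by simp [r, hf]) }

/-- The spheres around points in disjoint convex sets are homologically independent in the
complement of the points. -/
theorem linearIndependent_homologyMap (F : Type v) [Field F] {k : ℕ} (hk : k ≠ 0) {V : Type}
    [NormedAddCommGroup V] [NormedSpace ℝ V] {ι : Type} {U : ι → Set V} (hU : ∀ j, IsOpen (U j))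
    (hconv : ∀ j, Convex ℝ (U j)) (hdisj : Pairwise fun i j => Disjoint (U i) (U j))
    (e : ι → V ≃ₜ V) (heU : ∀ j, e j '' U j = Metric.ball 0 1)
    (heF : ∀ j, e j '' frontier (U j) = Metric.sphere 0 1) {p : ι → V} (hp : ∀ j, p j ∈ U j)
    (g : ι → C(Metric.sphere (0 : V) 1, {q : V // q ∉ Set.range p}))
    (hg : ∀ j s, (g j s : V) = (e j).symm s) {c : Homology F k (Metric.sphere (0 : V) 1)}
    (hc : c ≠ 0) : LinearIndependent F fun j => homologyMap F k (g j) c := by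
  have hmem (j) (s : Metric.sphere (0 : V) 1) : (e j).symm s ∈ frontier (U j) := by
    obtain ⟨x, hx, hxs⟩ := (heF j).ge s.2
    rwa [← hxs, Homeomorph.symm_apply_apply]
  -- Fills in all punctures except `p i`. The matrix of the classes under these maps turns out to be
  -- diagonal.
  let ρ (i : ι) : C({q : V // q ∉ Set.range p}, {q : V // q ≠ p i}) :=
    ⟨fun q => ⟨q.1, fun h => q.2 ⟨i, h.symm⟩⟩, by fun_prop⟩
  have hpne (i j : ι) (hij : i ≠ j) : p j ≠ p i := fun h =>
    Set.disjoint_left.mp (hdisj hij) (hp i) (h ▸ hp j)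
  -- The sphere around `U j` contracts along segments to `p j` within `closure (U j)`, which misses
  -- the open set `U i` and so misses `p i`.
  have hoff (i j : ι) (hij : i ≠ j) : homologyMap F k (ρ i) (homologyMap F k (g j) c) = 0 := by
    rw [← homologyMap_comp]
    refine homologyMap_eq_zero_of_nullhomotopic F hk ⟨⟨p j, hpne i j hij⟩, ?_⟩ c
    · refine homotopic_of_segment (p := fun q => q ≠ p i) _ _ fun s y hy h => ?_
      have hy' : y ∈ closure (U j) := (hconv j).closure.segment_subset
        (by rw [ContinuousMap.comp_apply]
            change (g j s : V) ∈ _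
            rw [hg]; exact frontier_subset_closure (hmem j s)) (subset_closure (hp j)) hy
      exact Set.disjoint_left.mp ((hdisj hij).closure_right (hU i)) (hp i) (h ▸ hy')
  -- The ambient homeomorphism `e i` turns this sphere into the unit sphere around a point of the
  -- open ball, where the inclusion is injective on homology.
  have hdiag (i : ι) : homologyMap F k (ρ i) (homologyMap F k (g i) c) ≠ 0 := by
    rw [← homologyMap_comp]
    let ε : C({q : V // q ≠ p i}, {q : V // q ≠ e i (p i)}) :=
      ⟨fun q => ⟨e i q.1, fun h => q.2 ((e i).injective h)⟩, by fun_prop⟩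
    have hball : ‖e i (p i)‖ < 1 := by
      have := (heU i).le ⟨p i, hp i, rfl⟩
      simpa using this
    intro h0
    refine hc (homologyMap_sphere_injective F k hball (ε.comp ((ρ i).comp (g i))) (fun s => ?_) ?_)
    · change e i (g i s : V) = s
      rw [hg, Homeomorph.apply_symm_apply]
    · rw [homologyMap_comp, h0, map_zero, map_zero]
  rw [linearIndependent_iff']
  intro s a ha i hi
  have := congrArg (homologyMap F k (ρ i)) ha
  rw [map_zero, map_sum, Finset.sum_eq_single i, map_smul] at this
  · exact (smul_eq_zero.mp this).resolve_right (hdiag i)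
  · intro j _ hj
    rw [map_smul, hoff i j hj.symm, smul_zero]
  · exact fun h => (h hi).elim

end NodalTopology

/-! ## The holes -/

namespace NodalTopology

theorem lam_pos {m : ℕ} (hm : 1 ≤ m) : 24 ≤ lam m := by
  have : (1 : ℝ) ≤ m := by exact_mod_cast hm
  rw [lam]
  nlinarith [Real.pi_gt_three]

theorem eta_pos {m : ℕ} (hm : 1 ≤ m) : 0 < eta m := by
  have := lam_pos hm
  rw [eta]
  positivity

/-- The exponential factor is at most `λ⁻⁴` where `x₁ ≤ 1`. -/
theorem eta_mul_exp_le {m : ℕ} (hm : 1 ≤ m) {t : ℝ} (ht : t ≤ 1) :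
    eta m * Real.exp (lam m * t) ≤ (lam m ^ 4)⁻¹ := by
  have h := lam_pos hm
  rw [eta, mul_right_comm, ← Real.exp_add]
  refine mul_le_of_le_one_left (by positivity) (Real.exp_le_one_iff.mpr ?_)
  nlinarith

theorem inv_lam_pow_four_lt {m : ℕ} (hm : 1 ≤ m) : (lam m ^ 4)⁻¹ < 1 / 256 := by
  have h := lam_pos hm
  have : (24 : ℝ) ^ 4 ≤ lam m ^ 4 := by gcongr
  rw [one_div]
  exact inv_strictAnti₀ (by norm_num) (by linarith)

/-! ### Convexity, openness and boundary of the holes -/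

/-- A quadratic polynomial times an exponential is convex where the polynomial is small. -/
theorem convexOn_quadratic_mul_exp {A B C p r L : ℝ} (hAB : B ^ 2 ≤ A * C)
    (hr : r ^ 2 ≤ C)
    (hN : ∀ t ∈ Set.Icc (0 : ℝ) 1, 4 * L ^ 2 * (A + 2 * B * t + C * t ^ 2) ≤ 1) :
    ConvexOn ℝ (Set.Icc 0 1)
      fun t => (A + 2 * B * t + C * t ^ 2) * Real.exp (-(L * (p + r * t))) := by
  have hexp (t : ℝ) : HasDerivAt (fun t => Real.exp (-(L * (p + r * t))))
      (Real.exp (-(L * (p + r * t))) * (-(L * r))) t := by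
    refine HasDerivAt.exp ?_
    exact ((((hasDerivAt_id t).const_mul r).const_add p).const_mul L).neg.congr_deriv (by simp)
  have hpoly (t : ℝ) : HasDerivAt (fun t => A + 2 * B * t + C * t ^ 2) (2 * B + 2 * C * t) t := by
    have := ((((hasDerivAt_id t).const_mul (2 * B)).const_add A).add
      (((hasDerivAt_id t).pow 2).const_mul C))
    refine this.congr_deriv ?_
    simp
    ring
  have hpoly' (t : ℝ) : HasDerivAt (fun t => 2 * B + 2 * C * t) (2 * C) t := by
    have := ((hasDerivAt_id t).const_mul (2 * C)).const_add (2 * B)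
    simpa using this
  refine convexOn_of_hasDerivWithinAt2_nonneg (convex_Icc 0 1) (by fun_prop)
    (fun t _ => ((hpoly t).mul (hexp t)).hasDerivWithinAt)
    (fun t _ => (((hpoly' t).mul (hexp t)).add
      ((hpoly t).mul ((hexp t).mul_const (-(L * r))))).hasDerivWithinAt) fun t ht => ?_
  have hNt := hN t (interior_subset ht)
  set N := A + 2 * B * t + C * t ^ 2 with hNdef
  set D := B + C * t with hD
  have hC : 0 ≤ C := (sq_nonneg r).trans hr
  have hDN : D ^ 2 ≤ N * C := by rw [hD, hNdef]; nlinarith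
  -- The second derivative divided by the exponential, with `D = N'/2`. From `D² ≤ NC`, `r² ≤ C` and
  -- `4L²N ≤ 1` one gets `|2LrD| ≤ C`, so the negative cross term is absorbed by `2C`.
  have key : 0 ≤ 2 * C - 4 * (L * r) * D + (L * r) ^ 2 * N := by
    have h1 : (2 * L * r * D) ^ 2 ≤ C ^ 2 := by
      have : 4 * L ^ 2 * (r ^ 2 * D ^ 2) ≤ 4 * L ^ 2 * (C * (N * C)) := by gcongr
      have h2 : 4 * L ^ 2 * N * C ^ 2 ≤ 1 * C ^ 2 := by gcongr
      nlinarith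
    have h2 : |2 * L * r * D| ≤ C := abs_le_of_sq_le_sq h1 hC
    have h3 : 0 ≤ (L * r) ^ 2 * N := by
      rcases hC.eq_or_lt with hC0 | hC0
      · have : r = 0 := by nlinarith
        simp [this]
      · have : 0 ≤ N := by
          by_contra hneg
          nlinarith [sq_nonneg D]
        positivity
    have := (abs_le.mp h2).2
    nlinarith
  have e : 2 * C * Real.exp (-(L * (p + r * t)))
        + (2 * B + 2 * C * t) * (Real.exp (-(L * (p + r * t))) * -(L * r))
      + ((2 * B + 2 * C * t) * (Real.exp (-(L * (p + r * t))) * -(L * r))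
        + N * (Real.exp (-(L * (p + r * t))) * -(L * r) * -(L * r)))
      = Real.exp (-(L * (p + r * t))) * (2 * C - 4 * (L * r) * D + (L * r) ^ 2 * N) := by
    rw [hD]; ring
  exact (mul_nonneg (Real.exp_nonneg _) key).trans_eq e.symm

/-- The first `l` coordinates. -/
noncomputable def head (l : ℕ) : E (l + 1) →ₗ[ℝ] E l where
  toFun q := WithLp.toLp 2 fun i => q i.castSucc
  map_add' _ _ := rfl
  map_smul' _ _ := rfl

theorem norm_head_sq {l : ℕ} (q : E (l + 1)) : ‖head l q‖ ^ 2 = ∑ i : Fin l, q i.castSucc ^ 2 := by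
  rw [EuclideanSpace.norm_sq_eq]
  exact Finset.sum_congr rfl fun i _ => sq_abs _

theorem norm_sq_eq_head {l : ℕ} (q : E (l + 1)) :
    ‖q‖ ^ 2 = ‖head l q‖ ^ 2 + q (Fin.last l) ^ 2 := by
  rw [norm_head_sq, EuclideanSpace.norm_sq_eq, Fin.sum_univ_castSucc]
  simp

theorem abs_apply_zero_le {l : ℕ} (hl : 1 ≤ l) (q : E (l + 1)) : |q 0| ≤ ‖head l q‖ :=
  PiLp.norm_apply_le (head l q) ⟨0, hl⟩

theorem mem_box_iff {l : ℕ} {q : E (l + 1)} :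
    q ∈ box l ↔ ‖head l q‖ ≤ 1 / 16 ∧ q (Fin.last l) ∈ Set.Icc (-(1 / 4) : ℝ) (1 / 4) := by
  rw [box, Set.mem_ofPred_eq, ← norm_head_sq, sq_le_sq₀ (norm_nonneg _) (by norm_num)]

theorem Phi_eq {l m : ℕ} (q : E (l + 1)) : Phi l m q = ‖head l q‖ ^ 2
    + eta m * Real.exp (lam m * q 0) * Real.cos (lam m * q (Fin.last l)) := by
  rw [Phi, norm_head_sq]

theorem continuous_head (l : ℕ) : Continuous (head l) := (head l).continuous_of_finiteDimensional

theorem continuous_Phi (l m : ℕ) : Continuous (Phi l m) := by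
  unfold Phi
  fun_prop

variable {l m : ℕ} (hl : 1 ≤ l) (hm : 1 ≤ m) {k : ℤ}

include hl hm

theorem amplitude_le {q : E (l + 1)} (hq : ‖head l q‖ ≤ 1 / 16) :
    eta m * Real.exp (lam m * q 0) ≤ (lam m ^ 4)⁻¹ :=
  eta_mul_exp_le hm (by linarith [le_abs_self (q 0), abs_apply_zero_le hl q])

/-- The cosine is at least `-1`, so the oscillating term cannot outweigh more than `λ⁻⁴`. -/
theorem norm_head_sq_lt {q : E (l + 1)} (hq : ‖head l q‖ ≤ 1 / 16) (h : Phi l m q < 0) :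
    ‖head l q‖ ^ 2 < (lam m ^ 4)⁻¹ := by
  have h1 := amplitude_le hl hm hq
  have h2 := Real.neg_one_le_cos (lam m * q (Fin.last l))
  have h3 : 0 < eta m * Real.exp (lam m * q 0) := mul_pos (eta_pos hm) (Real.exp_pos _)
  rw [Phi_eq] at h
  nlinarith

omit hl hm in
theorem cos_shift (k : ℤ) (x : ℝ) :
    Real.cos x = -Real.cos (x - Real.pi - k * (2 * Real.pi)) := by
  rw [Real.cos_sub_int_mul_two_pi, Real.cos_sub_pi, neg_neg]

omit hl in
theorem mem_Ioo_iff {z : ℝ} :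
    z ∈ Set.Ioo ((Real.pi / 2 + 2 * Real.pi * k) / lam m)
      ((3 * Real.pi / 2 + 2 * Real.pi * k) / lam m) ↔
    lam m * z - Real.pi - k * (2 * Real.pi) ∈ Set.Ioo (-(Real.pi / 2)) (Real.pi / 2) := by
  have h := lam_pos hm
  rw [Set.mem_Ioo, Set.mem_Ioo, div_lt_iff₀ (by linarith), lt_div_iff₀ (by linarith)]
  constructor <;> rintro ⟨h1, h2⟩ <;> constructor <;> linarith

omit hl in
/-- The hole with an index in range, with the condition on `z` simplified. -/
theorem mem_hole_iff (hk : -(m : ℤ) ≤ k) (hk' : k < m) {q : E (l + 1)} :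
    q ∈ hole l m k ↔ ‖head l q‖ ≤ 1 / 16 ∧
      lam m * q (Fin.last l) - Real.pi - k * (2 * Real.pi)
        ∈ Set.Ioo (-(Real.pi / 2)) (Real.pi / 2) ∧ Phi l m q < 0 := by
  rw [hole, Set.mem_ofPred_eq, mem_Ioo_iff hm, mem_box_iff]
  constructor
  · rintro ⟨⟨h1, -⟩, h2, h3⟩
    exact ⟨h1, h2, h3⟩
  · rintro ⟨h1, h2, h3⟩
    -- The bound on `z` is automatic: `λ/4 = 2πm`, and the slabs with these indices lie in `|λz| ≤
    -- 2πm`.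
    refine ⟨⟨h1, ?_⟩, h2, h3⟩
    have hpi := Real.pi_pos
    have h4 : -(m : ℝ) ≤ k := by exact_mod_cast hk
    have h5 : (k : ℝ) + 1 ≤ m := by exact_mod_cast hk'
    have h6 : (1 : ℝ) ≤ m := by exact_mod_cast hm
    rw [lam] at h2
    obtain ⟨h7, h8⟩ := h2
    have h9 : (0 : ℝ) < 8 * Real.pi * m := by positivity
    constructor
    · by_contra hneg
      push Not at hneg
      have : 8 * Real.pi * m * q (Fin.last l) < 8 * Real.pi * m * (-(1 / 4)) := by gcongr
      nlinarith
    · by_contra hneg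
      push Not at hneg
      have : 8 * Real.pi * m * (1 / 4) < 8 * Real.pi * m * q (Fin.last l) := by gcongr
      nlinarith

/-- The closed condition `|X| ≤ 1/16` is never attained with equality, since `Φ < 0` forces `|X|² <
λ⁻⁴ < 1/256`. The remaining conditions are open. -/
theorem isOpen_hole (hk : -(m : ℤ) ≤ k) (hk' : k < m) : IsOpen (hole l m k) := by
  have : hole l m k = {q | ‖head l q‖ < 1 / 16} ∩
      ({q | lam m * q (Fin.last l) - Real.pi - k * (2 * Real.pi)
        ∈ Set.Ioo (-(Real.pi / 2)) (Real.pi / 2)} ∩ {q | Phi l m q < 0}) := by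
    ext q
    rw [mem_hole_iff hm hk hk']
    refine and_congr_left fun h => ⟨fun h1 => ?_, fun h1 => le_of_lt h1⟩
    have h2 := norm_head_sq_lt hl hm h1 h.2
    have h3 := inv_lam_pow_four_lt hm
    change ‖head l q‖ < 1 / 16
    exact lt_of_pow_lt_pow_left₀ 2 (by norm_num) (by norm_num; linarith)
  rw [this]
  refine (isOpen_lt (continuous_head l).norm continuous_const).inter (IsOpen.inter ?_
    (isOpen_lt (continuous_Phi l m) continuous_const))
  exact isOpen_Ioo.preimage (by fun_prop)

/-- Dividing by `e^{λx₁}` turns `Φ < 0` into a convex function of `X` being less than `η cos θ`,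
which is concave for `|θ| ≤ π/2`. -/
theorem convex_hole (hk : -(m : ℤ) ≤ k) (hk' : k < m) : Convex ℝ (hole l m k) := by
  rw [convex_iff_forall_pos]
  intro a ha b hb s t hs ht hst
  rw [mem_hole_iff hm hk hk'] at ha hb ⊢
  have hL := lam_pos hm
  have hη := eta_pos hm
  -- The threshold `1/(2λ)` is what the convexity lemma requires: it makes `4λ²|X|² ≤ 1`. It follows
  -- from `|X|² < λ⁻⁴` and `4λ² ≤ λ⁴`.
  have hsmall {q : E (l + 1)} (h1 : ‖head l q‖ ≤ 1 / 16) (h2 : Phi l m q < 0) :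
      ‖head l q‖ ≤ (2 * lam m)⁻¹ := by
    have h3 := norm_head_sq_lt hl hm h1 h2
    refine (pow_le_pow_iff_left₀ (norm_nonneg _) (by positivity) two_ne_zero).mp (h3.le.trans ?_)
    rw [inv_pow]
    refine inv_anti₀ (by positivity) ?_
    nlinarith [sq_nonneg (lam m), mul_le_mul hL hL (by norm_num) (by linarith)]
  obtain ⟨ha1, ha2, ha3⟩ := ha
  obtain ⟨hb1, hb2, hb3⟩ := hb
  have hcomb (r : ℝ) (hr : ‖head l a‖ ≤ r) (hr' : ‖head l b‖ ≤ r) (τ : ℝ)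
      (hτ : τ ∈ Set.Icc (0 : ℝ) 1) : ‖head l a + τ • (head l b - head l a)‖ ≤ r := by
    have := convex_closedBall (0 : E l) r (x := head l a) (by simpa using hr) (y := head l b)
      (by simpa using hr') (sub_nonneg.mpr hτ.2) hτ.1 (by ring)
    rw [mem_closedBall_zero_iff] at this
    refine le_of_eq_of_le (congrArg norm ?_) this
    module
  have hab : s • a + t • b = a + t • (b - a) := by
    obtain rfl : s = 1 - t := by linarith
    module
  have ht1 : t ∈ Set.Icc (0 : ℝ) 1 := ⟨ht.le, by linarith⟩
  have hhead (τ : ℝ) : head l (a + τ • (b - a)) = head l a + τ • (head l b - head l a) := by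
    simp
  set θ : E (l + 1) → ℝ := fun q => lam m * q (Fin.last l) - Real.pi - k * (2 * Real.pi) with hθ
  have hθab : θ (s • a + t • b) = s • θ a + t • θ b := by
    simp only [hθ, PiLp.add_apply, PiLp.smul_apply, smul_eq_mul]
    obtain rfl : s = 1 - t := by linarith
    ring
  have hPhi (q : E (l + 1)) : Phi l m q < 0 ↔
      ‖head l q‖ ^ 2 * Real.exp (-(lam m * q 0)) < eta m * Real.cos (θ q) := by
    rw [Phi_eq, cos_shift k, Real.exp_neg, ← div_eq_mul_inv, div_lt_iff₀ (Real.exp_pos _), mul_neg,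
      ← sub_eq_add_neg, sub_neg, mul_right_comm]
  refine ⟨?_, ?_, ?_⟩
  · rw [hab, hhead]
    exact hcomb _ ha1 hb1 t ht1
  · change θ _ ∈ _
    rw [hθab]
    exact convex_Ioo _ _ ha2 hb2 hs.le ht.le hst
  · have hconv := convexOn_quadratic_mul_exp (A := ‖head l a‖ ^ 2)
      (B := inner ℝ (head l a) (head l b - head l a)) (C := ‖head l b - head l a‖ ^ 2)
      (p := a 0) (r := b 0 - a 0) (L := lam m) ?_ ?_ ?_
    · have h1 := hconv.2 (x := 0) (by simp) (y := 1) (by simp) hs.le ht.le hst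
      have h2 := strictConcaveOn_cos_Icc.concaveOn.2 (Set.Ioo_subset_Icc_self ha2)
        (Set.Ioo_subset_Icc_self hb2) hs.le ht.le hst
      have hquad (τ : ℝ) : ‖head l a‖ ^ 2 + 2 * inner ℝ (head l a) (head l b - head l a) * τ
          + ‖head l b - head l a‖ ^ 2 * τ ^ 2 = ‖head l (a + τ • (b - a))‖ ^ 2 := by
        rw [hhead, norm_add_sq_real, inner_smul_right, norm_smul, mul_pow, Real.norm_eq_abs, sq_abs]
        ring
      simp only [hquad] at h1
      rw [hPhi] at ha3 hb3 ⊢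
      simp only [smul_eq_mul, mul_zero, mul_one, zero_smul, one_smul, add_zero, zero_add,
        add_sub_cancel] at h1 h2
      rw [hθab, hab]
      simp only [PiLp.add_apply, PiLp.smul_apply, PiLp.sub_apply, smul_eq_mul]
      rw [mul_comm (b.ofLp 0 - a.ofLp 0) t] at h1
      refine h1.trans_lt (lt_of_lt_of_le ?_ (mul_le_mul_of_nonneg_left h2 hη.le))
      have := mul_lt_mul_of_pos_left ha3 hs
      have := mul_lt_mul_of_pos_left hb3 ht
      simp only [smul_eq_mul, hθ] at *
      nlinarith
    · rw [← mul_pow]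
      exact sq_le_sq' (by linarith [neg_le_of_abs_le (abs_real_inner_le_norm (head l a)
        (head l b - head l a))]) (real_inner_le_norm _ _)
    · rw [← sq_abs]
      gcongr
      have := abs_apply_zero_le hl (b - a)
      rwa [map_sub] at this
    · intro τ hτ
      have h1 := hcomb _ (hsmall ha1 ha3) (hsmall hb1 hb3) τ hτ
      have h2 : ‖head l a + τ • (head l b - head l a)‖ ^ 2 ≤ (2 * lam m)⁻¹ ^ 2 := by gcongr
      rw [norm_add_sq_real, inner_smul_right, norm_smul, mul_pow, Real.norm_eq_abs, sq_abs] at h2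
      calc _ ≤ 4 * lam m ^ 2 * (2 * lam m)⁻¹ ^ 2 := by
            gcongr
            linarith
        _ = 1 := by field_simp; norm_num

omit hl in
theorem nonempty_hole (hk : -(m : ℤ) ≤ k) (hk' : k < m) : (hole l m k).Nonempty := by
  have hL := lam_pos hm
  have hη := eta_pos hm
  let q : E (l + 1) := WithLp.toLp 2 (Fin.snoc (α := fun _ => ℝ) (fun _ : Fin l => 0)
    ((Real.pi + k * (2 * Real.pi)) / lam m))
  have hhead : head l q = 0 := by
    ext i
    change (Fin.snoc (α := fun _ => ℝ) (fun _ : Fin l => 0) _ : Fin (l + 1) → ℝ) i.castSucc = 0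
    simp
  have hlast : lam m * q (Fin.last l) = Real.pi + k * (2 * Real.pi) := by
    simp only [q, Fin.snoc_last]
    field_simp
  refine ⟨q, (mem_hole_iff hm hk hk').mpr ⟨by simp [hhead], ?_, ?_⟩⟩
  · rw [hlast]
    have := Real.pi_pos
    constructor <;> linarith
  · rw [Phi_eq, hhead, hlast, Real.cos_add_int_mul_two_pi, Real.cos_pi]
    have := mul_pos hη (Real.exp_pos (lam m * q 0))
    simp only [norm_zero]
    linarith

omit hl in
theorem disjoint_hole {k' : ℤ} (hkk' : k ≠ k') : Disjoint (hole l m k) (hole l m k') := by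
  rw [Set.disjoint_left]
  rintro q ⟨-, h1, -⟩ ⟨-, h2, -⟩
  rw [mem_Ioo_iff hm] at h1 h2
  have hpi := Real.pi_pos
  rcases lt_or_gt_of_ne hkk' with h | h
  · have : (k : ℝ) + 1 ≤ k' := by exact_mod_cast h
    nlinarith [h1.2, h2.1]
  · have : (k' : ℝ) + 1 ≤ k := by exact_mod_cast h
    nlinarith [h2.2, h1.1]

omit hl hm in
theorem isClosed_box (l : ℕ) : IsClosed (box l) := by
  have : box l = {q | ∑ i : Fin l, q i.castSucc ^ 2 ≤ (1 / 16) ^ 2} ∩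
      {q | q (Fin.last l) ∈ Set.Icc (-(1 / 4) : ℝ) (1 / 4)} := rfl
  rw [this]
  exact (isClosed_le (by fun_prop) continuous_const).inter (isClosed_Icc.preimage (by fun_prop))

omit hl hm in
theorem isBounded_box (l : ℕ) : Bornology.IsBounded (box l) := by
  refine (Metric.isBounded_closedBall (x := (0 : E (l + 1))) (r := 1)).subset fun q hq => ?_
  rw [mem_box_iff] at hq
  rw [mem_closedBall_zero_iff, ← sq_le_one_iff₀ (norm_nonneg q), norm_sq_eq_head]
  obtain ⟨h1, h2, h3⟩ := hq
  nlinarith [norm_nonneg (head l q)]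

/-- A limit point of the hole has `Φ ≤ 0` and `|θ| ≤ π/2`. If `Φ < 0`, then `cos θ > 0`, so `|θ| <
π/2` and the point is in the open hole itself. -/
theorem frontier_hole_subset (hk : -(m : ℤ) ≤ k) (hk' : k < m) :
    frontier (hole l m k) ⊆ {q | q ∈ box l ∧ Phi l m q = 0} := by
  intro q hq
  rw [(isOpen_hole hl hm hk hk').frontier_eq] at hq
  have hbox : q ∈ box l := closure_minimal (fun x hx => hx.1) (isClosed_box l) hq.1
  have hle : Phi l m q ≤ 0 := closure_minimal (t := {q | Phi l m q ≤ 0}) (fun x hx => hx.2.2.le)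
    (isClosed_le (continuous_Phi l m) continuous_const) hq.1
  have hz : lam m * q (Fin.last l) - Real.pi - k * (2 * Real.pi)
      ∈ Set.Icc (-(Real.pi / 2)) (Real.pi / 2) :=
    closure_minimal (t := {q : E (l + 1) | lam m * q (Fin.last l) - Real.pi - k * (2 * Real.pi)
      ∈ Set.Icc (-(Real.pi / 2)) (Real.pi / 2)})
      (fun x hx => Set.Ioo_subset_Icc_self ((mem_hole_iff hm hk hk').mp hx).2.1)
      (isClosed_Icc.preimage (by fun_prop)) hq.1
  refine ⟨hbox, hle.antisymm (le_of_not_gt fun hlt => ?_)⟩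
  refine hq.2 ((mem_hole_iff hm hk hk').mpr ⟨(mem_box_iff.mp hbox).1, ?_, hlt⟩)
  rw [Phi_eq, cos_shift k] at hlt
  have hcos : 0 < Real.cos (lam m * q (Fin.last l) - Real.pi - k * (2 * Real.pi)) := by
    have h3 : 0 < eta m * Real.exp (lam m * q 0) := mul_pos (eta_pos hm) (Real.exp_pos _)
    by_contra h
    nlinarith [sq_nonneg ‖head l q‖]
  constructor
  · refine hz.1.lt_of_ne fun h => ?_
    rw [← h, Real.cos_neg, Real.cos_pi_div_two] at hcos
    exact lt_irrefl _ hcos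
  · refine hz.2.lt_of_ne fun h => ?_
    rw [h, Real.cos_pi_div_two] at hcos
    exact lt_irrefl _ hcos

omit hl in
/-- Every point of the box with `Φ < 0` lies in a hole. -/
theorem exists_mem_hole {q : E (l + 1)} (hq : q ∈ box l) (h : Phi l m q < 0) :
    ∃ k : ℤ, -(m : ℤ) ≤ k ∧ k < m ∧ q ∈ hole l m k := by
  have hpi := Real.pi_pos
  have h6 : (1 : ℝ) ≤ m := by exact_mod_cast hm
  have hcos : Real.cos (lam m * q (Fin.last l)) < 0 := by
    have h3 : 0 < eta m * Real.exp (lam m * q 0) := mul_pos (eta_pos hm) (Real.exp_pos _)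
    rw [Phi_eq] at h
    by_contra h'
    nlinarith [sq_nonneg ‖head l q‖]
  set x := lam m * q (Fin.last l) with hx
  have hx1 : -(2 * Real.pi * m) ≤ x ∧ x ≤ 2 * Real.pi * m := by
    obtain ⟨-, h1, h2⟩ := hq
    have h9 : (0 : ℝ) < 8 * Real.pi * m := by positivity
    rw [hx, lam]
    constructor <;> nlinarith
  -- Reduces `x` to `[0, 2π)`, where a negative cosine means lying strictly between `π/2` and
  -- `3π/2`.
  let k := ⌊x / (2 * Real.pi)⌋
  have hk1 : k * (2 * Real.pi) ≤ x := (le_div_iff₀ (by positivity)).mp (Int.floor_le _)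
  have hk2 : x < (k + 1) * (2 * Real.pi) :=
    (div_lt_iff₀ (by positivity)).mp (Int.lt_floor_add_one _)
  have hlow : Real.pi / 2 < x - k * (2 * Real.pi) := by
    by_contra hneg
    have := Real.cos_nonneg_of_neg_pi_div_two_le_of_le (x := x - k * (2 * Real.pi))
      (by linarith) (by linarith)
    rw [Real.cos_sub_int_mul_two_pi] at this
    linarith
  have hhigh : x - k * (2 * Real.pi) < 3 * Real.pi / 2 := by
    by_contra hneg
    have := Real.cos_nonneg_of_neg_pi_div_two_le_of_le (x := x - (k + 1 : ℤ) * (2 * Real.pi))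
      (by push_cast; linarith) (by push_cast; linarith)
    rw [Real.cos_sub_int_mul_two_pi] at this
    linarith
  have hkm : -(m : ℤ) ≤ k := by
    refine Int.le_floor.mpr ((le_div_iff₀ (by positivity)).mpr ?_)
    push_cast
    linarith
  -- The endpoint `x = 2πm` would give `k = m`, but the remainder is known to exceed `π/2`.
  have hkm' : k < m := by
    by_contra hneg
    push Not at hneg
    have : (m : ℝ) ≤ k := by exact_mod_cast hneg
    nlinarith
  refine ⟨k, hkm, hkm', (mem_hole_iff hm hkm hkm').mpr ⟨(mem_box_iff.mp hq).1, ?_, h⟩⟩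
  constructor <;> linarith

end NodalTopology

/-! ## The nodal set and its projection -/

namespace NodalTopology

variable {n l m : ℕ} (h : l + 2 ≤ n)

/-- The point `(X, y, z, 0)` over `q = (X, z)`. -/
noncomputable def lift (n : ℕ) {l : ℕ} (q : E (l + 1)) (y : ℝ) : E n :=
  WithLp.toLp 2 fun i => if hi : i.val < l then q (Fin.castSucc ⟨i, hi⟩) else
    if i.val = l then y else if i.val = l + 1 then q (Fin.last l) else 0

theorem lift_apply_self (q : E (l + 1)) (y : ℝ) : lift n q y ⟨l, by omega⟩ = y := by
  simp [lift]

theorem proj_lift (q : E (l + 1)) (y : ℝ) : proj n l h (lift n q y) = q := by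
  ext i
  refine Fin.lastCases ?_ (fun i => ?_) i
  · simp [proj, lift]
  · simp [proj, lift]
    rfl

theorem continuous_lift (n : ℕ) {l : ℕ} (y : ℝ) : Continuous fun q : E (l + 1) => lift n q y := by
  refine (PiLp.continuous_toLp 2 _).comp (continuous_pi fun i => ?_)
  split_ifs <;> fun_prop

theorem continuous_proj : Continuous (proj n l h) := by
  refine (PiLp.continuous_toLp 2 _).comp (continuous_pi fun i => ?_)
  refine Fin.lastCases ?_ (fun i => ?_) i
  · simp only [Fin.snoc_last]
    fun_prop
  · simp only [Fin.snoc_castSucc]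
    fun_prop

theorem norm_lift_sq (h : l + 2 ≤ n) (q : E (l + 1)) (y : ℝ) : ‖lift n q y‖ ^ 2 = ‖q‖ ^ 2 + y ^ 2 := by
  let g : ℕ → ℝ := fun i => if hi : i < l then q (Fin.castSucc ⟨i, hi⟩) ^ 2 else
    if i = l then y ^ 2 else if i = l + 1 then q (Fin.last l) ^ 2 else 0
  have h1 : ‖lift n q y‖ ^ 2 = ∑ i : Fin n, g i := by
    rw [EuclideanSpace.norm_sq_eq]
    refine Finset.sum_congr rfl fun i _ => ?_
    simp only [lift, g, Real.norm_eq_abs, sq_abs]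
    split_ifs <;> simp
  have h2 : ∑ i ∈ Finset.range (l + 2), g i = ∑ i ∈ Finset.range n, g i := by
    refine Finset.sum_subset (Finset.range_mono h) fun i _ hi => ?_
    rw [Finset.mem_range, not_lt] at hi
    simp only [g]
    rw [dif_neg (by omega), if_neg (by omega), if_neg (by omega)]
  rw [h1, Fin.sum_univ_eq_sum_range, ← h2, Finset.sum_range_succ, Finset.sum_range_succ,
    ← Fin.sum_univ_eq_sum_range, norm_sq_eq_head, norm_head_sq]
  have h3 : ∑ i : Fin l, g i = ∑ i : Fin l, q i.castSucc ^ 2 :=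
    Finset.sum_congr rfl fun i _ => by simp [g]; rfl
  have h4 : g l = y ^ 2 := by simp [g]
  have h5 : g (l + 1) = q (Fin.last l) ^ 2 := by simp [g]
  rw [h3, h4, h5]
  ring

theorem u_eq_Phi_proj (hl : 1 ≤ l) (x : E n) :
    u n l h m x = Phi l m (proj n l h x) - l * x ⟨l, by omega⟩ ^ 2 := by
  have h0 : (proj n l h x) 0 = x ⟨0, by omega⟩ :=
    Fin.snoc_castSucc (α := fun _ => ℝ) (x ⟨l + 1, by omega⟩) (fun i : Fin l => x ⟨i, by omega⟩)
      ⟨0, hl⟩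
  have h1 : (proj n l h x) (Fin.last l) = x ⟨l + 1, by omega⟩ := by simp [proj]
  have h2 (i : Fin l) : (proj n l h x) i.castSucc = x ⟨i, by omega⟩ := by simp [proj]
  simp only [u, Phi, h0, h1, h2]
  ring

theorem u_lift (hl : 1 ≤ l) (q : E (l + 1)) (y : ℝ) :
    u n l h m (lift n q y) = Phi l m q - l * y ^ 2 := by
  rw [u_eq_Phi_proj h hl, proj_lift, lift_apply_self h]

/-- Membership in the ball of radius `1/2` holds because `|X|² + y² + z² ≤ 1/256 + 2/256 + 1/16 <
1/4`, using `y² ≤ Φ ≤ |X|² + 1/256`. -/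
theorem lift_mem_nodalSet (hl : 1 ≤ l) (hm : 1 ≤ m) {q : E (l + 1)} (hq : q ∈ box l)
    (y : ℝ) (hy : l * y ^ 2 = Phi l m q) : lift n q y ∈ nodalSet n l h m := by
  refine ⟨?_, ?_⟩
  · rw [Set.mem_ofPred_eq, u_lift h hl, hy, sub_self]
  · rw [mem_box_iff] at hq
    have hl' : (1 : ℝ) ≤ l := by exact_mod_cast hl
    have hy' : y ^ 2 ≤ Phi l m q := by
      rw [← hy]
      nlinarith [sq_nonneg y]
    have h1 := amplitude_le hl hm hq.1
    have h2 := inv_lam_pow_four_lt hm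
    have h3 : 0 < eta m * Real.exp (lam m * q 0) := mul_pos (eta_pos hm) (Real.exp_pos _)
    have h4 := Real.cos_le_one (lam m * q (Fin.last l))
    have h5 : Phi l m q ≤ ‖head l q‖ ^ 2 + 1 / 256 := by
      rw [Phi_eq]
      nlinarith
    have h6 : ‖head l q‖ ^ 2 ≤ (1 / 16) ^ 2 := pow_le_pow_left₀ (norm_nonneg _) hq.1 2
    have h7 : q (Fin.last l) ^ 2 ≤ (1 / 4) ^ 2 := sq_le_sq' (by linarith [hq.2.1]) hq.2.2
    rw [mem_ball_zero_iff]
    refine lt_of_pow_lt_pow_left₀ 2 (by norm_num) ?_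
    rw [norm_lift_sq h, norm_sq_eq_head]
    norm_num at *
    linarith

/-- On the nodal set `Φ = ℓ y² ≥ 0`. -/
theorem proj_notMem_hole (hl : 1 ≤ l) (k : ℤ) {x : E n} (hx : x ∈ nodalSet n l h m) :
    proj n l h x ∉ hole l m k := by
  rintro ⟨-, -, hneg⟩
  have := hx.1
  rw [Set.mem_ofPred_eq, u_eq_Phi_proj h hl] at this
  have : 0 ≤ (l : ℝ) * x ⟨l, by omega⟩ ^ 2 := by positivity
  linarith

theorem index_bounds (j : Fin (2 * m)) : -(m : ℤ) ≤ (j : ℤ) - m ∧ (j : ℤ) - m < m := by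
  have := j.2
  omega

theorem proj_nodalSet_inter_box (hl : 1 ≤ l) (hm : 1 ≤ m) :
    proj n l h '' nodalSet n l h m ∩ box l = box l \ ⋃ j, holes l m j := by
  ext q
  constructor
  · rintro ⟨⟨x, hx, rfl⟩, hq⟩
    refine ⟨hq, fun hmem => ?_⟩
    obtain ⟨j, hj⟩ := Set.mem_iUnion.mp hmem
    exact proj_notMem_hole h hl _ hx hj
  · rintro ⟨hq, hnot⟩
    refine ⟨?_, hq⟩
    have hPhi : 0 ≤ Phi l m q := by
      by_contra hneg
      obtain ⟨k, hk, hk', hqk⟩ := exists_mem_hole hm hq (not_le.mp hneg)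
      refine hnot (Set.mem_iUnion.mpr ⟨⟨(k + m).toNat, by omega⟩, ?_⟩)
      have : (((k + m).toNat : ℕ) : ℤ) - m = k := by omega
      rw [holes, this]
      exact hqk
    have hl' : (0 : ℝ) < l := by exact_mod_cast hl
    refine ⟨lift n q √(Phi l m q / l), lift_mem_nodalSet h hl hm hq _ ?_, proj_lift h q _⟩
    rw [Real.sq_sqrt (by positivity)]
    field_simp

theorem isOpen_holes (hl : 1 ≤ l) (hm : 1 ≤ m) (j : Fin (2 * m)) : IsOpen (holes l m j) :=
  isOpen_hole hl hm (index_bounds j).1 (index_bounds j).2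

theorem convex_holes (hl : 1 ≤ l) (hm : 1 ≤ m) (j : Fin (2 * m)) : Convex ℝ (holes l m j) :=
  convex_hole hl hm (index_bounds j).1 (index_bounds j).2

theorem isConnected_holes (hl : 1 ≤ l) (hm : 1 ≤ m) (j : Fin (2 * m)) :
    IsConnected (holes l m j) :=
  ⟨nonempty_hole hm (index_bounds j).1 (index_bounds j).2,
    (convex_holes hl hm j).isPreconnected⟩

theorem pairwise_disjoint_holes (hm : 1 ≤ m) :
    Pairwise fun i j : Fin (2 * m) => Disjoint (holes l m i) (holes l m j) := by
  intro i j hij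
  refine disjoint_hole hm fun heq => hij (Fin.ext ?_)
  omega

/-- The nodal set contains spheres over the boundaries of the holes, and these are homologically
independent after projection. -/
theorem exists_spheres (hl : 1 ≤ l) (hm : 1 ≤ m) :
    ∃ γ : Fin (2 * m) → C(Metric.sphere (0 : E (l + 1)) 1, nodalSet n l h m),
      (∀ j, Topology.IsEmbedding (γ j) ∧
        Topology.IsEmbedding (fun s => proj n l h (γ j s)) ∧
        Set.range (fun s => proj n l h (γ j s)) = frontier (holes l m j)) ∧
      ∀ p : Fin (2 * m) → E (l + 1), (∀ j, p j ∈ holes l m j) →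
        ∃ π : C(nodalSet n l h m, {q : E (l + 1) // q ∉ Set.range p}),
          (∀ x, (π x : E (l + 1)) = proj n l h x) ∧
          ∀ (F : Type v) [Field F],
            ∃ c : Homology F l (Metric.sphere (0 : E (l + 1)) 1),
              Submodule.span F {c} = ⊤ ∧
              LinearIndependent F
                (fun j => homologyMap F l π (homologyMap F l (γ j) c)) := by
  have hopen := isOpen_holes (m := m) hl hm
  -- A bounded convex set with nonempty interior is carried to the unit ball by a homeomorphism of
  -- the ambient space, with boundary going to the unit sphere.
  have hex (j : Fin (2 * m)) := exists_homeomorph_image_interior_closure_frontier_eq_unitBall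
    (convex_holes hl hm j) ((hopen j).interior_eq.symm ▸ (isConnected_holes hl hm j).nonempty)
    ((isBounded_box l).subset fun q hq => hq.1)
  choose e heU _ heF using hex
  have hmem (j) (s : Metric.sphere (0 : E (l + 1)) 1) : (e j).symm s ∈ frontier (holes l m j) := by
    obtain ⟨x, hx, hxs⟩ := (heF j).ge s.2
    rwa [← hxs, Homeomorph.symm_apply_apply]
  let γ (j : Fin (2 * m)) : C(Metric.sphere (0 : E (l + 1)) 1, nodalSet n l h m) :=
    -- Height `y = 0` works because `Φ` vanishes on the boundary of a hole.
    ⟨fun s => ⟨lift n ((e j).symm s) 0, by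
      have := frontier_hole_subset hl hm (index_bounds j).1 (index_bounds j).2 (hmem j s)
      exact lift_mem_nodalSet h hl hm this.1 0 (by rw [this.2]; ring)⟩,
      by
        refine Continuous.subtype_mk ?_ _
        exact (continuous_lift n 0).comp ((e j).symm.continuous.comp continuous_subtype_val)⟩
  have hγ (j s) : proj n l h (γ j s) = (e j).symm s := proj_lift h _ _
  have hemb (j) : Topology.IsEmbedding fun s => proj n l h (γ j s) := by
    simp only [hγ]
    exact (e j).symm.isEmbedding.comp .subtypeVal
  refine ⟨γ, fun j => ⟨?_, hemb j, ?_⟩, fun p hp => ?_⟩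
  · exact .of_comp (γ j).continuous ((continuous_proj h).comp continuous_subtype_val) (hemb j)
  · simp only [hγ]
    rw [← (e j).injective.image_injective.eq_iff, heF, ← Set.range_comp]
    simp only [Function.comp_def, Homeomorph.apply_symm_apply, Subtype.range_coe]
  · let π : C(nodalSet n l h m, {q : E (l + 1) // q ∉ Set.range p}) :=
      ⟨fun x => ⟨proj n l h x, by
        rintro ⟨j, hj⟩
        exact proj_notMem_hole h hl _ x.2 (hj ▸ hp j)⟩, by
        refine Continuous.subtype_mk ?_ _
        exact (continuous_proj h).comp continuous_subtype_val⟩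
    refine ⟨π, fun x => rfl, fun F _ => ?_⟩
    obtain ⟨c, hc, hc0⟩ := exists_generator_homology_sphere F hl
    refine ⟨c, hc, ?_⟩
    simp only [← homologyMap_comp]
    exact linearIndependent_homologyMap F (by omega) hopen (convex_holes hl hm)
      (pairwise_disjoint_holes hm) e (fun j => by rw [← heU j, (hopen j).interior_eq]) heF hp
      (fun j => π.comp (γ j)) (fun j s => hγ j s) hc0

/-- Classes whose images under a linear map are independent are themselves independent; the map is
the one induced by the projection. -/
theorem le_betti_nodalSet (hl : 1 ≤ l) (hm : 1 ≤ m) (F : Type v) [Field F] :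
    ((2 * m : ℕ) : Cardinal.{v}) ≤ betti F l (nodalSet n l h m) := by
  obtain ⟨γ, -, hγ⟩ := exists_spheres.{v} h hl hm
  choose p hp using fun j => (isConnected_holes (l := l) hl hm j).nonempty
  obtain ⟨π, -, hπ⟩ := hγ p hp
  obtain ⟨c, -, hc⟩ := hπ F
  have := (LinearIndependent.of_comp (homologyMap F l π) hc).cardinal_lift_le_rank
  simpa [betti] using this

end NodalTopology

/-! ## Harmonicity, frequency and regularity -/

namespace NodalTopology

open Metric

/-- The derivative of `u`. -/
noncomputable def uDeriv (n l : ℕ) (h : l + 2 ≤ n) (m : ℕ) (x : E n) : E n →L[ℝ] ℝ :=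
  (∑ i : Fin l, (2 * x ⟨i, by omega⟩) • EuclideanSpace.proj (𝕜 := ℝ) (⟨i, by omega⟩ : Fin n))
    - (2 * l * x ⟨l, by omega⟩) • EuclideanSpace.proj (𝕜 := ℝ) (⟨l, by omega⟩ : Fin n)
    + (eta m * lam m * Real.exp (lam m * x ⟨0, by omega⟩) * Real.cos (lam m * x ⟨l + 1, by omega⟩)) •
      EuclideanSpace.proj (𝕜 := ℝ) (⟨0, by omega⟩ : Fin n)
    - (eta m * lam m * Real.exp (lam m * x ⟨0, by omega⟩) * Real.sin (lam m * x ⟨l + 1, by omega⟩)) •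
      EuclideanSpace.proj (𝕜 := ℝ) (⟨l + 1, by omega⟩ : Fin n)

/-- The quadratic part `|X|² - ℓ y²` of `u`. -/
noncomputable def quadraticPart (n l : ℕ) (h : l + 2 ≤ n) (x : E n) : ℝ :=
  (∑ i : Fin l, x ⟨i, by omega⟩ ^ 2) - l * x ⟨l, by omega⟩ ^ 2

variable {n l m : ℕ} (h : l + 2 ≤ n)

theorem hasFDerivAt_coord (i : Fin n) (x : E n) :
    HasFDerivAt (fun x : E n => x i) (EuclideanSpace.proj (𝕜 := ℝ) i : E n →L[ℝ] ℝ) x :=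
  (EuclideanSpace.proj (𝕜 := ℝ) i : E n →L[ℝ] ℝ).hasFDerivAt

theorem hasFDerivAt_u (x : E n) : HasFDerivAt (u n l h m) (uDeriv n l h m x) x := by
  have h1 := HasFDerivAt.fun_sum (u := Finset.univ) fun (i : Fin l) _ =>
    (hasFDerivAt_coord (⟨i, by omega⟩ : Fin n) x).pow 2
  have h2 := ((hasFDerivAt_coord (⟨l, by omega⟩ : Fin n) x).pow 2).const_mul (l : ℝ)
  have h3 := (((hasFDerivAt_coord (⟨0, by omega⟩ : Fin n) x).const_mul (lam m)).exp.const_mul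
    (eta m)).mul ((hasFDerivAt_coord (⟨l + 1, by omega⟩ : Fin n) x).const_mul (lam m)).cos
  refine ((h1.sub h2).add h3).congr_fderiv ?_
  ext v
  simp [uDeriv]
  ring

theorem fderiv_u : fderiv ℝ (u n l h m) = uDeriv n l h m :=
  funext fun x => (hasFDerivAt_u h x).fderiv

theorem contDiff_u {k : WithTop ℕ∞} : ContDiff ℝ k (u n l h m) := by
  unfold u
  fun_prop

/-- The `ℓ` squares in `X` contribute `2ℓ`, cancelled by `-ℓ y²`. The second derivatives of `e^{λx₁}
cos(λz)` in `x₁` and `z` cancel as well. -/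
theorem laplacian_u (x : E n) : Laplacian.laplacian (u n l h m) x = 0 := by
  rw [InnerProductSpace.laplacian_eq_iteratedFDeriv_orthonormalBasis _
    (EuclideanSpace.basisFun (Fin n) ℝ)]
  have h1 := HasFDerivAt.fun_sum (u := Finset.univ) fun (i : Fin l) _ =>
    ((hasFDerivAt_coord (⟨i, by omega⟩ : Fin n) x).const_mul 2).smul_const
      (EuclideanSpace.proj (𝕜 := ℝ) (⟨i, by omega⟩ : Fin n) : E n →L[ℝ] ℝ)
  have h2 := ((hasFDerivAt_coord (⟨l, by omega⟩ : Fin n) x).const_mul (2 * l : ℝ)).smul_const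
    (EuclideanSpace.proj (𝕜 := ℝ) (⟨l, by omega⟩ : Fin n) : E n →L[ℝ] ℝ)
  have h3 := ((((hasFDerivAt_coord (⟨0, by omega⟩ : Fin n) x).const_mul (lam m)).exp.const_mul
    (eta m * lam m)).mul ((hasFDerivAt_coord (⟨l + 1, by omega⟩ : Fin n) x).const_mul
      (lam m)).cos).smul_const (EuclideanSpace.proj (𝕜 := ℝ) (⟨0, by omega⟩ : Fin n) : E n →L[ℝ] ℝ)
  have h4 := ((((hasFDerivAt_coord (⟨0, by omega⟩ : Fin n) x).const_mul (lam m)).exp.const_mul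
    (eta m * lam m)).mul ((hasFDerivAt_coord (⟨l + 1, by omega⟩ : Fin n) x).const_mul
      (lam m)).sin).smul_const
      (EuclideanSpace.proj (𝕜 := ℝ) (⟨l + 1, by omega⟩ : Fin n) : E n →L[ℝ] ℝ)
  have h5 : HasFDerivAt (uDeriv n l h m) _ x := ((h1.sub h2).add h3).sub h4
  simp only [iteratedFDeriv_two_apply, fderiv_u, h5.fderiv]
  simp [Finset.sum_add_distrib, Finset.sum_sub_distrib]
  rw [Finset.sum_comm]
  simp [ite_apply, apply_ite (DFunLike.coe (F := E n →L[ℝ] ℝ))]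
  ring

theorem harmonicOnNhd_u (s : Set (E n)) : InnerProductSpace.HarmonicOnNhd (u n l h m) s :=
  fun _ _ => ⟨(contDiff_u h).contDiffAt, .of_forall fun x => laplacian_u h x⟩

theorem norm_gradient_u (x : E n) : ‖gradient (u n l h m) x‖ = ‖uDeriv n l h m x‖ := by
  rw [gradient, LinearIsometryEquiv.norm_map, fderiv_u]

/-! ### Gradient bound and lower bound for the boundary integral -/

theorem norm_proj_le (i : Fin n) : ‖(EuclideanSpace.proj (𝕜 := ℝ) i : E n →L[ℝ] ℝ)‖ ≤ 1 :=
  ContinuousLinearMap.opNorm_le_bound _ zero_le_one fun x => by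
    simpa using PiLp.norm_apply_le x i

theorem norm_smul_proj_le {c b : ℝ} (hc : |c| ≤ b) (i : Fin n) :
    ‖c • (EuclideanSpace.proj (𝕜 := ℝ) i : E n →L[ℝ] ℝ)‖ ≤ b := by
  rw [norm_smul, Real.norm_eq_abs]
  exact (mul_le_of_le_one_right (abs_nonneg c) (norm_proj_le i)).trans hc

theorem abs_coord_le {x : E n} (hx : ‖x‖ ≤ 1) (i : Fin n) : |x i| ≤ 1 :=
  (PiLp.norm_apply_le x i).trans hx

theorem abs_oscillation_deriv_le (hm : 1 ≤ m) {t c : ℝ} (ht : t ≤ 1) (hc : |c| ≤ 1) :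
    |eta m * lam m * Real.exp (lam m * t) * c| ≤ 1 := by
  have hl := lam_pos hm
  have h1 := eta_mul_exp_le hm ht
  have h0 : 0 ≤ eta m * Real.exp (lam m * t) := mul_nonneg (eta_pos hm).le (Real.exp_pos _).le
  have h2 : lam m * (lam m ^ 4)⁻¹ ≤ 1 := by
    rw [← div_eq_mul_inv, div_le_one (by positivity)]
    exact le_self_pow₀ (by linarith) (by norm_num)
  rw [abs_mul, mul_right_comm, abs_of_nonneg (mul_nonneg h0 (by linarith))]
  refine mul_le_one₀ ?_ (abs_nonneg _) hc
  nlinarith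

/-- The constant is `2ℓ` from the `X` terms, `2ℓ` from `y`, and `1` for each of the two derivatives
of the oscillating term. -/
theorem norm_uDeriv_le (hm : 1 ≤ m) {x : E n} (hx : ‖x‖ ≤ 1) :
    ‖uDeriv n l h m x‖ ≤ 4 * l + 2 := by
  have hc := abs_coord_le hx
  have h1 := norm_sum_le_of_le Finset.univ fun (i : Fin l) _ =>
    norm_smul_proj_le (b := 2) (c := 2 * x ⟨i, by omega⟩)
    (by rw [abs_mul, abs_two]; linarith [hc ⟨i, by omega⟩]) (⟨i, by omega⟩ : Fin n)
  have h2 := norm_smul_proj_le (b := 2 * l) (c := 2 * l * x ⟨l, by omega⟩)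
    (by
      rw [abs_mul, abs_of_nonneg (by positivity : (0 : ℝ) ≤ 2 * l)]
      exact mul_le_of_le_one_right (by positivity) (hc ⟨l, by omega⟩)) (⟨l, by omega⟩ : Fin n)
  have h3 := norm_smul_proj_le (abs_oscillation_deriv_le hm ((le_abs_self _).trans (hc ⟨0, by omega⟩))
    (Real.abs_cos_le_one (lam m * x ⟨l + 1, by omega⟩))) (⟨0, by omega⟩ : Fin n)
  have h4 := norm_smul_proj_le (abs_oscillation_deriv_le hm ((le_abs_self _).trans (hc ⟨0, by omega⟩))
    (Real.abs_sin_le_one (lam m * x ⟨l + 1, by omega⟩))) (⟨l + 1, by omega⟩ : Fin n)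
  rw [uDeriv]
  refine (norm_sub_le_of_le (norm_add_le_of_le (norm_sub_le_of_le h1 h2) h3) h4).trans ?_
  simp
  linarith

theorem continuous_norm_gradient_u : Continuous fun x => ‖gradient (u n l h m) x‖ ^ 2 := by
  simp only [norm_gradient_u, ← fderiv_u]
  exact ((contDiff_u (k := 1) h).continuous_fderiv one_ne_zero).norm.pow 2

theorem integrableOn_norm_gradient_u :
    IntegrableOn (fun x => ‖gradient (u n l h m) x‖ ^ 2) (ball 0 1) volume :=
  ((continuous_norm_gradient_u h).continuousOn.integrableOn_compact
    (isCompact_closedBall 0 1)).mono_set ball_subset_closedBall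

theorem integral_norm_gradient_u_le (hm : 1 ≤ m) :
    ∫ x in ball (0 : E n) 1, ‖gradient (u n l h m) x‖ ^ 2 ≤
      (4 * l + 2) ^ 2 * volume.real (ball (0 : E n) 1) := by
  refine (setIntegral_mono_on (g := fun _ => (4 * (l : ℝ) + 2) ^ 2)
    (integrableOn_norm_gradient_u h) (integrableOn_const measure_ball_lt_top.ne)
    measurableSet_ball fun x hx => ?_).trans_eq ?_
  · rw [norm_gradient_u]
    gcongr
    exact norm_uDeriv_le h hm (mem_ball_zero_iff.mp hx).le
  · rw [setIntegral_const, smul_eq_mul, mul_comm]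

theorem continuous_quadraticPart : Continuous (quadraticPart n l h) := by
  unfold quadraticPart
  fun_prop

theorem abs_u_sub_quadraticPart_le (hm : 1 ≤ m) {x : E n} (hx : ‖x‖ ≤ 1) :
    |u n l h m x - quadraticPart n l h x| ≤ (lam m ^ 4)⁻¹ := by
  rw [u, quadraticPart, add_sub_cancel_left, abs_mul,
    abs_of_nonneg (mul_nonneg (eta_pos hm).le (Real.exp_pos _).le)]
  exact (mul_le_of_le_one_right (mul_nonneg (eta_pos hm).le (Real.exp_pos _).le)
    (Real.abs_cos_le_one _)).trans (eta_mul_exp_le hm ((le_abs_self _).trans (abs_coord_le hx _)))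

theorem integrable_sphere {f : E n → ℝ} (hf : Continuous f) :
    Integrable (fun ω : sphere (0 : E n) 1 => f ω ^ 2) (volume : Measure (E n)).toSphere :=
  ((hf.comp continuous_subtype_val).pow 2).integrable_of_hasCompactSupport
    (HasCompactSupport.of_compactSpace _)

/-- The integrand is continuous and nonnegative, and nonzero at the unit vector in the `y`
direction, where the quadratic part is `-ℓ`. -/
theorem integral_quadraticPart_pos (hl : 1 ≤ l) :
    0 < ∫ ω : sphere (0 : E n) 1, quadraticPart n l h ω ^ 2 ∂(volume : Measure (E n)).toSphere := by
  have hmem : EuclideanSpace.single (⟨l, by omega⟩ : Fin n) (1 : ℝ) ∈ sphere (0 : E n) 1 := by simp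
  refine ((continuous_quadraticPart h).comp continuous_subtype_val |>.pow 2)
    |>.integral_pos_of_hasCompactSupport_nonneg_nonzero (HasCompactSupport.of_compactSpace _)
    (fun _ => sq_nonneg _) (x := ⟨_, hmem⟩) (pow_ne_zero 2 ?_)
  have : ∀ i : Fin l, (i : ℕ) ≠ l := fun i => i.2.ne
  simp [quadraticPart, this]
  omega

/-- The surface integral of `u²` on the unit sphere is bounded below by that of its quadratic
part. -/
theorem le_sphereIntegralSq (hm : 1 ≤ m) :
    (∫ ω : sphere (0 : E n) 1, quadraticPart n l h ω ^ 2 ∂(volume : Measure (E n)).toSphere) / 2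
      - (lam m)⁻¹ * (volume : Measure (E n)).toSphere.real Set.univ
      ≤ sphereIntegralSq (u n l h m) 1 := by
  have hq := integrable_sphere (continuous_quadraticPart h)
  have hc : Integrable (fun _ : sphere (0 : E n) 1 => (lam m)⁻¹) (volume : Measure (E n)).toSphere :=
    integrable_const _
  have hl := lam_pos hm
  -- The actual error is `λ⁻⁸`; the cruder `λ⁻¹` keeps the threshold for `m` linear.
  have hle : ((lam m ^ 4)⁻¹) ^ 2 ≤ (lam m)⁻¹ := by
    rw [← inv_pow, ← pow_mul]
    exact pow_le_of_le_one (by positivity) (inv_le_one_of_one_le₀ (by linarith)) (by norm_num)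
  rw [sphereIntegralSq, one_pow, one_mul, ← integral_div, mul_comm, ← smul_eq_mul,
    ← integral_const, ← integral_sub (hq.div_const 2) hc]
  simp only [one_smul]
  refine integral_mono ((hq.div_const 2).sub hc) (integrable_sphere (contDiff_u (k := 0) h).continuous)
    fun ω => ?_
  have h1 := abs_u_sub_quadraticPart_le h hm (norm_eq_of_mem_sphere ω).le
  have h2 := sq_le_sq' (neg_le_of_abs_le h1) (le_of_abs_le h1)
  -- The inequality `u² ≥ q²/2 - (u - q)²`, equivalent to `(2u - q)² ≥ 0`.
  nlinarith [sq_nonneg (2 * u n l h m ω - quadraticPart n l h ω)]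

theorem exists_frequency_le (hl : 1 ≤ l) : ∃ (C : ℝ) (m₀ : ℕ), 1 ≤ m₀ ∧ ∀ m, m₀ ≤ m →
    0 < sphereIntegralSq (u n l h m) 1 ∧ frequency (u n l h m) 1 ≤ C := by
  have hQ := integral_quadraticPart_pos (n := n) h hl
  set Q := ∫ ω : sphere (0 : E n) 1, quadraticPart n l h ω ^ 2 ∂(volume : Measure (E n)).toSphere
  set V := (volume : Measure (E n)).toSphere.real Set.univ with hV
  -- For `λ ≥ 4V/Q` the error `V/λ` is at most `Q/4`, so the boundary integral stays above `Q/2 -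
  -- Q/4`, independently of `m`.
  obtain ⟨k, hk⟩ := exists_nat_ge (4 * V / Q)
  refine ⟨(4 * l + 2) ^ 2 * volume.real (ball (0 : E n) 1) / (Q / 4), k + 1, by omega,
    fun m hm => ?_⟩
  have hm1 : 1 ≤ m := by omega
  have hlam : 4 * V / Q ≤ lam m := by
    have : (k : ℝ) ≤ m := by exact_mod_cast (by omega : k ≤ m)
    rw [lam]
    nlinarith [Real.pi_gt_three, Nat.cast_nonneg (α := ℝ) m]
  have hpos : 0 < lam m := by linarith [lam_pos hm1]
  have hsmall : (lam m)⁻¹ * V ≤ Q / 4 := by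
    rw [inv_mul_le_iff₀ hpos]
    rw [div_le_iff₀ hQ] at hlam
    linarith
  have hlow : Q / 4 ≤ sphereIntegralSq (u n l h m) 1 := by
    linarith [le_sphereIntegralSq (l := l) h hm1]
  refine ⟨by linarith, ?_⟩
  rw [frequency, one_mul]
  have := integral_norm_gradient_u_le h hm1
  gcongr

/-- At a critical zero the derivatives in `y`, `z` and the other `xᵢ` leave only `t = x₁`, with `t²
+ rc = 0`, `2t + λrc = 0` and `c = ±1`. Eliminating `rc` gives `t = 0` or `t = 2/λ`. The first
contradicts `r > 0`; the second gives `4/λ² ≤ r ≤ λ⁻⁴`, impossible for `λ ≥ 24`. -/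
theorem fderiv_u_ne_zero (hl : 1 ≤ l) (hm : 1 ≤ m) {x : E n} (hx : u n l h m x = 0) :
    fderiv ℝ (u n l h m) x ≠ 0 := by
  have hlam := lam_pos hm
  have heta := eta_pos hm
  intro hd
  rw [fderiv_u] at hd
  have hpart (k : Fin n) : uDeriv n l h m x (EuclideanSpace.single k 1) = 0 := by rw [hd]; rfl
  simp only [uDeriv, sub_apply, add_apply, sum_apply, smul_apply, PiLp.proj_apply, PiLp.single_apply, smul_eq_mul, mul_ite, mul_one, mul_zero, Fin.ext_iff] at hpart
  have hne (i : Fin l) : (i : ℕ) ≠ l ∧ (i : ℕ) ≠ l + 1 := ⟨i.2.ne, by omega⟩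
  have hy : x ⟨l, by omega⟩ = 0 := by
    simpa [hne, show 0 ≠ l by omega, show l ≠ 0 by omega] using hpart ⟨l, by omega⟩
  have hz : Real.sin (lam m * x ⟨l + 1, by omega⟩) = 0 := by
    simpa [hne, heta.ne', show lam m ≠ 0 by linarith] using hpart ⟨l + 1, by omega⟩
  have hi (i : Fin l) := hpart ⟨i, by omega⟩
  simp only [← Fin.ext_iff, Finset.sum_ite_eq', Finset.mem_univ, if_true, (hne _).1.symm,
    (hne _).2.symm, if_false, sub_zero] at hi
  have hX (i : Fin l) (hi0 : (i : ℕ) ≠ 0) : x ⟨i, by omega⟩ = 0 := by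
    simpa [hi0.symm] using hi i
  have h0 := hi ⟨0, hl⟩
  simp only [if_true] at h0
  have hsum : ∑ i : Fin l, x ⟨i, by omega⟩ ^ 2 = x ⟨0, by omega⟩ ^ 2 := by
    rw [Finset.sum_eq_single ⟨0, hl⟩ (fun i _ hi => ?_) (by simp)]
    rw [hX i fun h' => hi (Fin.ext h'), zero_pow two_ne_zero]
  rw [u, hsum, hy] at hx
  set t := x ⟨0, by omega⟩
  set c := Real.cos (lam m * x ⟨l + 1, by omega⟩) with hc
  have hc2 : c ^ 2 = 1 := by
    have := Real.sin_sq_add_cos_sq (lam m * x ⟨l + 1, by omega⟩)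
    rw [hz, ← hc] at this
    linarith
  set r := eta m * Real.exp (lam m * t) with hr
  have hrpos : 0 < r := mul_pos heta (Real.exp_pos _)
  have ht : t * (2 - lam m * t) = 0 := by linear_combination h0 - lam m * hx
  rcases mul_eq_zero.mp ht with ht | ht
  · have : r * c = 0 := by linear_combination hx - t * ht
    rw [(mul_eq_zero.mp this).resolve_left hrpos.ne'] at hc2
    norm_num at hc2
  · have hlt : lam m * t = 2 := by linarith
    have hrle : r * lam m ^ 4 ≤ 1 := by
      -- The amplitude bound applies because `t = 2/λ ≤ 1`, so the point need not be assumed to lie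
      -- in the unit ball.
      have := eta_mul_exp_le hm (t := t) (by nlinarith)
      rwa [← one_div, le_div_iff₀ (by positivity)] at this
    have htr : t ^ 2 ≤ r := by
      nlinarith [Real.neg_one_le_cos (lam m * x ⟨l + 1, by omega⟩)]
    have h4 : 4 * lam m ^ 2 ≤ r * lam m ^ 4 := by
      calc 4 * lam m ^ 2 = t ^ 2 * lam m ^ 4 := by linear_combination (-(lam m) ^ 2 * (lam m * t + 2)) * hlt
        _ ≤ _ := by gcongr
    nlinarith

theorem vanishingOrder_eq_one {f : E n → ℝ} {x : E n} (hf : f x = 0) (hd : fderiv ℝ f x ≠ 0) :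
    vanishingOrder f x = 1 := by
  refine le_antisymm (sInf_le ⟨1, by simp, fun h1 => hd ?_⟩) (le_sInf ?_)
  · ext v
    have := congrArg (fun g => g fun _ => v) h1
    simpa using this
  · rintro _ ⟨k, rfl, hk⟩
    rcases k.eq_zero_or_pos with rfl | hk0
    · exact absurd (by ext; simp [hf]) hk
    · exact_mod_cast hk0

end NodalTopology

theorem theorem1 (n l : ℕ) (hn : 3 ≤ n) (hl : 1 ≤ l) (h : l + 2 ≤ n) :
    ∃ (C : ℝ) (m₀ : ℕ), ∀ m : ℕ, m₀ ≤ m →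
      -- harmonicity on the unit ball
      InnerProductSpace.HarmonicOnNhd (u n l h m) (Metric.ball 0 1) ∧
      -- (i) the frequency at scale 1 is well defined and bounded independently of `m`
      (IntegrableOn (fun x => ‖gradient (u n l h m) x‖ ^ 2) (Metric.ball 0 1) volume ∧
        0 < sphereIntegralSq (u n l h m) 1 ∧
        frequency (u n l h m) 1 ≤ C) ∧
      -- (ii) zero is a regular value, and nodal points have vanishing order exactly 1
      ((∀ x ∈ Metric.ball (0 : E n) 1, u n l h m x = 0 → fderiv ℝ (u n l h m) x ≠ 0) ∧
        ∀ x ∈ nodalSet n l h m, vanishingOrder (u n l h m) x = 1) ∧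
      -- (iii) the Betti bound over every field
      (∀ (F : Type v) [Field F], ((2 * m : ℕ) : Cardinal.{v}) ≤ betti F l (nodalSet n l h m)) ∧
      -- the `2m` holes of the projected nodal set
      ((∀ j, IsOpen (holes l m j) ∧ IsConnected (holes l m j)) ∧
        Pairwise (fun i j => Disjoint (holes l m i) (holes l m j)) ∧
        proj n l h '' nodalSet n l h m ∩ box l = box l \ ⋃ j, holes l m j) ∧
      -- the `2m` embedded spheres, and the independence of their projected classes
      ∃ γ : Fin (2 * m) → C(Metric.sphere (0 : E (l + 1)) 1, nodalSet n l h m),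
        (∀ j, Topology.IsEmbedding (γ j) ∧
          Topology.IsEmbedding (fun s => proj n l h (γ j s)) ∧
          Set.range (fun s => proj n l h (γ j s)) = frontier (holes l m j)) ∧
        ∀ p : Fin (2 * m) → E (l + 1), (∀ j, p j ∈ holes l m j) →
          ∃ π : C(nodalSet n l h m, {q : E (l + 1) // q ∉ Set.range p}),
            (∀ x, (π x : E (l + 1)) = proj n l h x) ∧
            ∀ (F : Type v) [Field F],
              ∃ c : Homology F l (Metric.sphere (0 : E (l + 1)) 1),
                Submodule.span F {c} = ⊤ ∧
                LinearIndependent F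
                  (fun j => homologyMap F l π (homologyMap F l (γ j) c)) := by
  obtain ⟨C, m₀, h₀, hC⟩ := exists_frequency_le (n := n) h hl
  refine ⟨C, m₀, fun m hm => ?_⟩
  have hm1 : 1 ≤ m := h₀.trans hm
  exact ⟨harmonicOnNhd_u h _, ⟨integrableOn_norm_gradient_u h, hC m hm⟩,
    ⟨fun x _ hx => fderiv_u_ne_zero h hl hm1 hx,
      fun x hx => vanishingOrder_eq_one hx.1 (fderiv_u_ne_zero h hl hm1 hx.1)⟩,
    fun F _ => le_betti_nodalSet h hl hm1 F,
    ⟨fun j => ⟨isOpen_holes hl hm1 j, isConnected_holes hl hm1 j⟩, pairwise_disjoint_holes hm1,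
      proj_nodalSet_inter_box h hl hm1⟩,
    exists_spheres h hl hm1⟩
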